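/- Let $\mathbb{D}$ be the open unit disk, $\mathbb{T}$ the unit circle, $m$ the normalized Lebesgue measure on $\mathbb{T}$, and $H^2$ the Hardy space of analytic functions $f:\mathbb{D}\to\mathbb{C}$ with $\|f\|^2=\sup_{0<r<1}\frac1{2\pi}\int_0^{2\pi}|f(re^{it})|^2\,dt<\infty$. Let $\varphi:\mathbb{D}\to\mathbb{D}$ be analytic, with radial limit function $\varphi^*(\xi)=\lim_{r\to1^-}\varphi(r\xi)$ (defined for $m$-almost every $\xi\in\mathbb{T}$). Then there exists $w\in H^2$, $w\not\equiv0$, such that the weighted composition operator $M_wC_\varphi: f\mapsto w\cdot(f\circ\varphi)$ is a (bounded) Hilbert--Schmidt operator from $H^2$ to $H^2$ if and only if $$\int_{\mathbb{T}}\log\Big(\frac1{1-|\varphi^*|}\Big)\,dm<+\infty ,$$ where the integrand is $+\infty$ at points where $|\varphi^*|=1$. -/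

import Mathlib

open Filter Topology MeasureTheory Set Metric
open scoped ENNReal

noncomputable section

namespace HardySpace

/-- The integral mean `(1/2π) ∫₀^{2π} |f(r e^{it})|² dt`. -/
def mean2 (f : ℂ → ℂ) (r : ℝ) : ℝ :=
  (2 * Real.pi)⁻¹ * ∫ t in (0 : ℝ)..2 * Real.pi, ‖f (r * Complex.exp (t * Complex.I))‖ ^ 2

/-- The `n`-th Taylor coefficient of `f` at the origin. -/
def coeff (f : ℂ → ℂ) (n : ℕ) : ℂ := (n.factorial : ℂ)⁻¹ * iteratedDeriv n f 0

theorem integral_exp_int (k : ℤ) :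
    ∫ t in (0 : ℝ)..2 * Real.pi, Complex.exp (k * (t * Complex.I)) =
      if k = 0 then (2 * Real.pi : ℂ) else 0 := by
  split_ifs with hk
  · simp [hk]
  · have h0 : (k : ℂ) * Complex.I ≠ 0 := by simp [hk]
    have h := integral_exp_mul_complex (a := 0) (b := 2 * Real.pi) h0
    have e : (fun t : ℝ => Complex.exp (k * (t * Complex.I))) =
        fun t : ℝ => Complex.exp (k * Complex.I * t) := by
      funext t; congr 1; ring
    rw [e, h]
    have : (k : ℂ) * Complex.I * ((2 * Real.pi : ℝ) : ℂ) = k * (2 * Real.pi * Complex.I) := by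
      push_cast; ring
    rw [this, Complex.exp_int_mul_two_pi_mul_I]
    simp

/-- Parseval's identity for an absolutely convergent power series on a circle. -/
theorem hasSum_mean2 {f : ℂ → ℂ} {c : ℕ → ℂ} {r : ℝ} (hr : 0 ≤ r)
    (hs : Summable fun n => ‖c n‖ * r ^ n)
    (hf : ∀ z : ℂ, ‖z‖ = r → HasSum (fun n => c n * z ^ n) (f z)) :
    HasSum (fun n => ‖c n‖ ^ 2 * r ^ (2 * n)) (mean2 f r) := by
  let F : ℕ × ℕ → ℝ → ℂ := fun p t =>
    (c p.1 * r ^ p.1) * (starRingEnd ℂ) (c p.2 * r ^ p.2) *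
      Complex.exp (((p.1 : ℤ) - (p.2 : ℤ) : ℤ) * (t * Complex.I))
  have hn : ∀ n, ‖c n * (r : ℂ) ^ n‖ = ‖c n‖ * r ^ n := fun n => by
    simp [abs_of_nonneg hr]
  have hFn : ∀ p t, ‖F p t‖ = (‖c p.1‖ * r ^ p.1) * (‖c p.2‖ * r ^ p.2) := by
    intro p t
    have : (((p.1 : ℤ) - (p.2 : ℤ) : ℤ) : ℂ) * (t * Complex.I) =
        ((((p.1 : ℤ) - (p.2 : ℤ) : ℤ) * t : ℝ) : ℂ) * Complex.I := by push_cast; ring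
    simp only [F, norm_mul, RCLike.norm_conj, this, Complex.norm_exp_ofReal_mul_I]
    simp [abs_of_nonneg hr]
  have hFs : Summable fun p : ℕ × ℕ => (‖c p.1‖ * r ^ p.1) * (‖c p.2‖ * r ^ p.2) :=
    hs.mul_of_nonneg hs (fun n => by positivity) (fun n => by positivity)
  have hFt : ∀ t : ℝ, HasSum (fun p => F p t)
      ((‖f (r * Complex.exp (t * Complex.I))‖ ^ 2 : ℝ) : ℂ) := by
    intro t
    set z : ℂ := r * Complex.exp (t * Complex.I) with hz
    have hzn : ‖z‖ = r := by simp [hz, Complex.norm_exp_ofReal_mul_I, abs_of_nonneg hr]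
    have h1 := hf z hzn
    have h2 : HasSum (fun n => (starRingEnd ℂ) (c n * z ^ n)) ((starRingEnd ℂ) (f z)) :=
      Complex.hasSum_conj'.mpr (by simpa using h1)
    have e1 : ∀ p : ℕ × ℕ, F p t = (c p.1 * z ^ p.1) * (starRingEnd ℂ) (c p.2 * z ^ p.2) := by
      intro p
      have : Complex.exp ((((p.1 : ℤ) - (p.2 : ℤ) : ℤ) : ℂ) * (t * Complex.I)) =
          Complex.exp (t * Complex.I) ^ p.1 *
            (starRingEnd ℂ) (Complex.exp (t * Complex.I) ^ p.2) := by
        rw [map_pow, ← Complex.exp_conj, ← Complex.exp_nat_mul, ← Complex.exp_nat_mul,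
          ← Complex.exp_add]
        congr 1
        simp; ring
      simp only [F, this, hz, map_mul, map_pow, mul_pow]
      ring
    have h3 : Summable fun p : ℕ × ℕ =>
        (c p.1 * z ^ p.1) * (starRingEnd ℂ) (c p.2 * z ^ p.2) := by
      refine Summable.of_norm ?_
      refine hFs.congr fun p => ?_
      rw [← hFn p t, e1 p]
    have h4 := h1.mul h2 h3
    rw [Complex.mul_conj, Complex.normSq_eq_norm_sq] at h4
    exact h4.congr_fun e1
  have hFc : ∀ p, Continuous (F p) := by
    intro p; fun_prop
  have hint := intervalIntegral.hasSum_integral_of_dominated_convergence (μ := volume)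
    (a := 0) (b := 2 * Real.pi) (F := F)
    (f := fun t => ((‖f (r * Complex.exp (t * Complex.I))‖ ^ 2 : ℝ) : ℂ))
    (fun p _ => (‖c p.1‖ * r ^ p.1) * (‖c p.2‖ * r ^ p.2))
    (fun p => (hFc p).aestronglyMeasurable)
    (fun p => ae_of_all _ fun t _ => (hFn p t).le)
    (ae_of_all _ fun t _ => hFs)
    intervalIntegrable_const
    (ae_of_all _ fun t _ => hFt t)
  have hval : ∀ p : ℕ × ℕ, ∫ t in (0 : ℝ)..2 * Real.pi, F p t =
      if p.1 = p.2 then ((2 * Real.pi * (‖c p.1‖ ^ 2 * r ^ (2 * p.1)) : ℝ) : ℂ) else 0 := by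
    intro p
    simp only [F, intervalIntegral.integral_const_mul, integral_exp_int]
    by_cases h : p.1 = p.2
    · rw [if_pos (by omega), if_pos h, ← h, Complex.mul_conj, Complex.normSq_eq_norm_sq, hn]
      push_cast; ring
    · rw [if_neg (by omega), if_neg h, mul_zero]
  simp_rw [hval] at hint
  have hinj : Function.Injective (fun n : ℕ => (n, n)) := fun a b h => (Prod.ext_iff.1 h).1
  rw [← hinj.hasSum_iff] at hint
  · simp only [Function.comp_def, if_true] at hint
    rw [intervalIntegral.integral_ofReal] at hint
    have h5 := (Complex.hasSum_ofReal.mp hint).mul_left (2 * Real.pi)⁻¹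
    refine (h5.congr_fun fun n => ?_)
    field_simp
  · intro p hp
    rw [if_neg]
    intro h
    exact hp ⟨p.1, Prod.ext rfl h⟩

theorem hasSum_taylor {f : ℂ → ℂ} (hf : DifferentiableOn ℂ f (ball 0 1)) {z : ℂ}
    (hz : ‖z‖ < 1) : HasSum (fun n => coeff f n * z ^ n) (f z) := by
  have h := Complex.hasSum_taylorSeries_on_ball hf (z := z) (by simpa using hz)
  refine h.congr_fun fun n => ?_
  simp [coeff]; ring

theorem summable_coeff {f : ℂ → ℂ} (hf : DifferentiableOn ℂ f (ball 0 1)) {r : ℝ}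
    (hr : 0 ≤ r) (hr1 : r < 1) : Summable fun n => ‖coeff f n‖ * r ^ n := by
  have h := (hasSum_taylor hf (z := (r : ℂ)) (by simpa [abs_of_nonneg hr] using hr1)).summable.norm
  refine h.congr fun n => ?_
  simp [abs_of_nonneg hr]

theorem hasSum_mean2_coeff {f : ℂ → ℂ} (hf : DifferentiableOn ℂ f (ball 0 1)) {r : ℝ}
    (hr : 0 ≤ r) (hr1 : r < 1) :
    HasSum (fun n => ‖coeff f n‖ ^ 2 * r ^ (2 * n)) (mean2 f r) :=
  hasSum_mean2 hr (summable_coeff hf hr hr1) fun _ hz => hasSum_taylor hf (hz ▸ hr1)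

theorem sum_coeff_le {f : ℂ → ℂ} (hf : DifferentiableOn ℂ f (ball 0 1)) {C : ℝ}
    (hC : C ∈ upperBounds (mean2 f '' Ioo 0 1)) (s : Finset ℕ) :
    ∑ n ∈ s, ‖coeff f n‖ ^ 2 ≤ C := by
  have hle : ∀ r ∈ Ioo (0 : ℝ) 1, ∑ n ∈ s, ‖coeff f n‖ ^ 2 * r ^ (2 * n) ≤ C := fun r hr =>
    (sum_le_hasSum s (fun n _ => mul_nonneg (sq_nonneg _) (pow_nonneg hr.1.le _))
      (hasSum_mean2_coeff hf hr.1.le hr.2)).trans (hC ⟨r, hr, rfl⟩)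
  have hcont : Continuous fun r : ℝ => ∑ n ∈ s, ‖coeff f n‖ ^ 2 * r ^ (2 * n) := by fun_prop
  have ht := (hcont.tendsto 1).mono_left (nhdsWithin_le_nhds (s := Iio 1))
  have h := le_of_tendsto ht (by
    filter_upwards [Ioo_mem_nhdsLT (zero_lt_one' ℝ)] with r hr using hle r hr)
  simpa using h

theorem isLUB_mean2 {f : ℂ → ℂ} (hf : DifferentiableOn ℂ f (ball 0 1))
    (hs : Summable fun n => ‖coeff f n‖ ^ 2) :
    IsLUB (mean2 f '' Ioo 0 1) (∑' n, ‖coeff f n‖ ^ 2) := by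
  constructor
  · rintro _ ⟨r, hr, rfl⟩
    refine hasSum_le (fun n => ?_) (hasSum_mean2_coeff hf hr.1.le hr.2) hs.hasSum
    exact mul_le_of_le_one_right (sq_nonneg _) (pow_le_one₀ hr.1.le hr.2.le)
  · intro C hC
    exact hs.tsum_le_of_sum_le (sum_coeff_le hf hC)

theorem bddAbove_mean2_iff {f : ℂ → ℂ} (hf : DifferentiableOn ℂ f (ball 0 1)) :
    BddAbove (mean2 f '' Ioo 0 1) ↔ Memℓp (coeff f) 2 := by
  rw [memℓp_gen_iff (by simp)]
  have e : (fun i => ‖coeff f i‖ ^ (2 : ℝ≥0∞).toReal) = fun i => ‖coeff f i‖ ^ 2 := by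
    funext i; simp
  rw [e]
  refine ⟨fun ⟨C, hC⟩ => ?_, fun h => (isLUB_mean2 hf h).bddAbove⟩
  exact summable_of_sum_le (fun n => sq_nonneg _) (sum_coeff_le hf hC)

theorem contDiffAt_zero {f : ℂ → ℂ} (hf : DifferentiableOn ℂ f (ball 0 1)) (n : ℕ) :
    ContDiffAt ℂ n f 0 :=
  (hf.analyticAt (ball_mem_nhds 0 one_pos)).contDiffAt

theorem coeff_add {f g : ℂ → ℂ} (hf : DifferentiableOn ℂ f (ball 0 1))
    (hg : DifferentiableOn ℂ g (ball 0 1)) : coeff (f + g) = coeff f + coeff g := by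
  funext n
  simp only [coeff, Pi.add_apply]
  rw [iteratedDeriv_add (contDiffAt_zero hf n) (contDiffAt_zero hg n), mul_add]

theorem coeff_smul {f : ℂ → ℂ} (hf : DifferentiableOn ℂ f (ball 0 1)) (a : ℂ) :
    coeff (a • f) = a • coeff f := by
  funext n
  simp only [coeff, Pi.smul_apply, smul_eq_mul]
  rw [iteratedDeriv_const_smul (contDiffAt_zero hf n)]
  simp only [smul_eq_mul]; ring

end HardySpace

/-- The analytic functions on the unit disk whose quadratic integral means over the circles
`|z| = r < 1` are bounded. A function on the disk is represented by its extension by `0` to `ℂ`,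
so that two elements are equal iff they agree on the disk. -/
def hardySubmodule : Submodule ℂ (ℂ → ℂ) where
  carrier := {f | DifferentiableOn ℂ f (ball 0 1) ∧ (∀ z ∉ ball (0 : ℂ) 1, f z = 0) ∧
    BddAbove (HardySpace.mean2 f '' Ioo 0 1)}
  zero_mem' := ⟨differentiableOn_const 0, fun _ _ => rfl, ⟨0, by
    rintro _ ⟨r, _, rfl⟩
    simp [HardySpace.mean2]⟩⟩
  add_mem' := by
    rintro f g ⟨hf, hf0, hfb⟩ ⟨hg, hg0, hgb⟩
    refine ⟨hf.add hg, fun z hz => by simp [hf0 z hz, hg0 z hz], ?_⟩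
    rw [HardySpace.bddAbove_mean2_iff hf] at hfb
    rw [HardySpace.bddAbove_mean2_iff hg] at hgb
    rw [HardySpace.bddAbove_mean2_iff (hf.add hg), HardySpace.coeff_add hf hg]
    exact hfb.add hgb
  smul_mem' := by
    rintro a f ⟨hf, hf0, hfb⟩
    refine ⟨hf.const_smul a, fun z hz => by simp [hf0 z hz], ?_⟩
    rw [HardySpace.bddAbove_mean2_iff hf] at hfb
    rw [HardySpace.bddAbove_mean2_iff (hf.const_smul a), HardySpace.coeff_smul hf a]
    exact hfb.const_smul a

/-- The Hardy space `H²` of the unit disk. (This is a type of its own, so that its topology is the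
norm topology below and not the one of pointwise convergence.) -/
def H2 : Type := hardySubmodule

namespace H2

instance : AddCommGroup H2 := inferInstanceAs (AddCommGroup hardySubmodule)

instance : Module ℂ H2 := inferInstanceAs (Module ℂ hardySubmodule)

instance : CoeFun H2 fun _ => ℂ → ℂ := ⟨fun f => f.1⟩

/-- The sequence of Taylor coefficients, as a linear map into `ℓ²`. -/
def coeffs : H2 →ₗ[ℂ] lp (fun _ : ℕ => ℂ) 2 where
  toFun f := ⟨HardySpace.coeff f, (HardySpace.bddAbove_mean2_iff f.2.1).1 f.2.2.2⟩
  map_add' f g := Subtype.ext (HardySpace.coeff_add f.2.1 g.2.1)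
  map_smul' a f := Subtype.ext (HardySpace.coeff_smul f.2.1 a)

theorem coeffs_injective : Function.Injective coeffs := by
  intro f g h
  have h' : HardySpace.coeff f = HardySpace.coeff g := congrArg Subtype.val h
  refine Subtype.ext (funext fun z => ?_)
  by_cases hz : z ∈ ball (0 : ℂ) 1
  · have hz' : ‖z‖ < 1 := by simpa using hz
    have h1 := HardySpace.hasSum_taylor f.2.1 hz'
    rw [h'] at h1
    exact h1.unique (HardySpace.hasSum_taylor g.2.1 hz')
  · rw [f.2.2.1 z hz, g.2.2.1 z hz]

/-- The inner product of `H²` is `⟪f, g⟫ = ∑ₙ conj (aₙ) bₙ`, where `aₙ`, `bₙ` are the Taylor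
coefficients; by `H2.isLUB_norm_sq` below, its norm is the supremum of the integral means. -/
instance : NormedAddCommGroup H2 := NormedAddCommGroup.induced H2 _ coeffs coeffs_injective

instance : InnerProductSpace ℂ H2 := InnerProductSpace.induced coeffs

theorem coeffs_surjective : Function.Surjective coeffs := by
  intro c
  have hc : Summable fun n => ‖c n‖ ^ 2 := by
    have h := lp.memℓp c
    rw [memℓp_gen_iff (by simp)] at h
    simpa using h
  obtain ⟨B, hB⟩ : ∃ B, ∀ n, ‖c n‖ ≤ B := ⟨‖c‖, fun n => lp.norm_apply_le_norm (by simp) c n⟩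
  have hB0 : 0 ≤ B := (norm_nonneg _).trans (hB 0)
  have hsum : ∀ r : ℝ, 0 ≤ r → r < 1 → Summable fun n => ‖c n‖ * r ^ n := fun r h0 h1 =>
    Summable.of_nonneg_of_le (fun n => by positivity)
      (fun n => mul_le_mul_of_nonneg_right (hB n) (by positivity))
      ((summable_geometric_of_lt_one h0 h1).mul_left B)
  have hs : ∀ z : ℂ, ‖z‖ < 1 → Summable fun n => c n * z ^ n := fun z hz =>
    Summable.of_norm (by simpa using hsum ‖z‖ (norm_nonneg z) hz)
  let g : ℂ → ℂ := fun z => ∑' n, c n * z ^ n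
  have hg : DifferentiableOn ℂ g (ball 0 1) := by
    intro z hz
    obtain ⟨r, hzr, hr1⟩ := exists_between (show ‖z‖ < 1 by simpa using hz)
    have hr0 : 0 ≤ r := (norm_nonneg z).trans hzr.le
    have h := Complex.differentiableOn_tsum_of_summable_norm (U := ball (0 : ℂ) r)
      (F := fun n z => c n * z ^ n) (hsum r hr0 hr1) (fun n => by fun_prop) isOpen_ball
      (fun n w hw => by
        rw [norm_mul, norm_pow]
        have : ‖w‖ ≤ r := by simpa using (mem_ball.1 hw).le
        gcongr)
    exact (h.differentiableAt (isOpen_ball.mem_nhds (by simpa using hzr))).differentiableWithinAt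
  let f : ℂ → ℂ := (ball (0 : ℂ) 1).indicator g
  have hfg : ∀ z, ‖z‖ < 1 → f z = g z := fun z hz =>
    Set.indicator_of_mem (show z ∈ ball (0 : ℂ) 1 by simpa using hz) g
  have hf : DifferentiableOn ℂ f (ball 0 1) :=
    hg.congr fun z hz => hfg z (by simpa using hz)
  have hco : HardySpace.coeff f = c := by
    have h0 : HasSum (fun n => ‖HardySpace.coeff f n - c n‖ ^ 2 * (1 / 2 : ℝ) ^ (2 * n))
        (HardySpace.mean2 (fun _ => 0) (1 / 2)) := by
      refine HardySpace.hasSum_mean2 (c := fun n => HardySpace.coeff f n - c n) (by norm_num) ?_ ?_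
      · refine Summable.of_nonneg_of_le (fun n => by positivity) (fun n => ?_)
          ((HardySpace.summable_coeff hf (r := 1 / 2) (by norm_num) (by norm_num)).add
            (hsum (1 / 2) (by norm_num) (by norm_num)))
        rw [← add_mul]
        gcongr
        exact norm_sub_le _ _
      · intro z hz
        have hz1 : ‖z‖ < 1 := by rw [hz]; norm_num
        have h := (HardySpace.hasSum_taylor hf hz1).sub (hs z hz1).hasSum
        have e : f z - ∑' n, c n * z ^ n = 0 := by rw [hfg z hz1]; exact sub_self _
        rw [e] at h
        simpa only [sub_mul] using h
    have hm : HardySpace.mean2 (fun _ => 0) (1 / 2) = 0 := by simp [HardySpace.mean2]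
    rw [hm, hasSum_zero_iff_of_nonneg (fun n => by positivity)] at h0
    funext n
    have := congrFun h0 n
    simpa [sub_eq_zero] using this
  have hmem : Memℓp (HardySpace.coeff f) 2 := hco ▸ lp.memℓp c
  exact ⟨⟨f, hf, fun z hz => Set.indicator_of_notMem hz g,
    (HardySpace.bddAbove_mean2_iff hf).2 hmem⟩, Subtype.ext hco⟩

theorem norm_coeffs (f : H2) : ‖coeffs f‖ = ‖f‖ := rfl

instance : CompleteSpace H2 :=
  (LinearIsometryEquiv.ofSurjective ⟨coeffs, norm_coeffs⟩
    coeffs_surjective).toIsometryEquiv.completeSpace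

theorem isLUB_norm_sq (f : H2) : IsLUB (HardySpace.mean2 f '' Ioo 0 1) (‖f‖ ^ 2) := by
  have h := lp.norm_rpow_eq_tsum (p := 2) (by simp) (coeffs f)
  have hm := (HardySpace.bddAbove_mean2_iff f.2.1).1 f.2.2.2
  rw [memℓp_gen_iff (by simp)] at hm
  simp only [ENNReal.toReal_ofNat, Real.rpow_ofNat] at h hm
  rw [← norm_coeffs, h]
  exact HardySpace.isLUB_mean2 f.2.1 hm

end H2

/-- `T` is a Hilbert–Schmidt operator: `∑ᵢ ‖T eᵢ‖² < ∞` for some orthonormal basis `(eᵢ)`. -/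
def IsHilbertSchmidt {E F : Type*} [NormedAddCommGroup E] [InnerProductSpace ℂ E]
    [NormedAddCommGroup F] [InnerProductSpace ℂ F] (T : E →L[ℂ] F) : Prop :=
  ∃ (s : Set E) (b : HilbertBasis s ℂ E), Summable fun i => ‖T (b i)‖ ^ 2

/-- The weighted composition operator `M_w C_φ`, as a map on functions: `f ↦ w · (f ∘ φ)`. -/
def weightedComp (w φ f : ℂ → ℂ) : ℂ → ℂ := fun z => w z * f (φ z)

/-- The radial limit `φ*(ξ) = lim_{r → 1⁻} φ(r ξ)`. -/
def radialLimit (φ : ℂ → ℂ) (ξ : ℂ) : ℂ := limUnder (𝓝[<] (1 : ℝ)) fun r : ℝ => φ (r * ξ)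

/-- Normalized Lebesgue measure `m` on the unit circle, as a measure on `ℂ`: the image of
`dt / 2π` on `(0, 2π]` under `t ↦ e^{it}`. -/
def circleMeasure : Measure ℂ :=
  Measure.map (fun t : ℝ => Complex.exp (t * Complex.I))
    (ENNReal.ofReal (2 * Real.pi)⁻¹ • volume.restrict (Ioc 0 (2 * Real.pi)))

/-- The function `log (1 / (1 - |ζ|))` with values in `[0, ∞]`, for `|ζ| ≤ 1`; its value is `∞`
if `|ζ| = 1`. -/
def logInvDist (ζ : ℂ) : ℝ≥0∞ := (ENNReal.log (1 / (1 - ‖ζ‖ₑ))).toENNReal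

end

/-! ### Radial limits of bounded analytic functions -/

namespace HardySpace
open Real (circleAverage)

/-! For an orthonormal basis `b` of `H2`, Parseval applied to the reproducing kernel at `a` gives `∑
‖b i a‖² = 1 / (1 - ‖a‖²)`. With `a = φ z`, the pointwise sum of `‖T (b i)‖²` is `|w|² / (1 -
|φ|²)`, so the Hilbert–Schmidt condition amounts to bounded circle means of this function.

Necessity: `log y ≤ y` with `y = |w|² / (1 - |φ|)` bounds `-log (1 - |φ|)` by `2|w|² / (1 - |φ|²) -
2 log |w|`. Jensen's formula bounds the means of `log |w|` below, so the means of `-log (1 - |φ|)`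
are bounded, and Fatou's lemma carries the bound to the radial limits.

Sufficiency: take the outer function with `|w|² = exp P[log (1 - |φ*|)]`, where `P` is the Poisson
integral. Jensen's inequality for `exp` gives `|w|² ≤ 1 - P[|φ*|] ≤ 1 - |φ| ≤ 1 - |φ|²`, so `|w|² /
(1 - |φ|²) ≤ 1`.

Both halves need radial limits almost everywhere. A primitive of `φ` is Lipschitz, hence
differentiable along the circle almost everywhere, and at such points its derivative `φ` converges
radially. -/

theorem mem_sphere_one {ζ : ℂ} (h : ζ ∈ sphere (0 : ℂ) |(1 : ℝ)|) : ‖ζ‖ = 1 := by simpa using h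

theorem sub_ne_zero_of_norm_ne {a b : ℂ} (h : ‖a‖ ≠ ‖b‖) : a - b ≠ 0 := fun h0 =>
  h (by rw [sub_eq_zero.1 h0])

/-- Cauchy's formula for the derivative, for functions continuous up to the boundary. -/
theorem deriv_eq_circleAverage {F : ℂ → ℂ} (hF : DiffContOnCl ℂ F (ball 0 1)) {w : ℂ}
    (hw : w ∈ ball (0 : ℂ) 1) :
    deriv F w = circleAverage (fun ζ => ζ / (ζ - w) ^ 2 * F ζ) 0 1 := by
  have hc : ContinuousOn F (sphere (0 : ℂ) |(1 : ℝ)|) := by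
    rw [abs_one]
    exact hF.2.mono (sphere_subset_closedBall.trans_eq (closure_ball 0 one_ne_zero).symm)
  have hi : CircleIntegrable F 0 1 := hc.circleIntegrable'
  have h1 := hasDerivAt_circleAverage_herglotzRieszKernel_smul hi hw
  -- The Herglotz kernel is `2ζ/(ζ - w) - 1`, so its average against `F` is `2 F w - F 0`.
  -- Differentiating in `w` under the integral yields `2 F'`.
  have h2 : (fun w => circleAverage (fun ζ => herglotzRieszKernel 0 w ζ • F ζ) 0 1) =ᶠ[𝓝 w]
      fun w => 2 * F w - F 0 := by
    filter_upwards [isOpen_ball.mem_nhds hw] with z hz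
    have hz1 : ‖z‖ < 1 := by simpa using hz
    have e : circleAverage (fun ζ => herglotzRieszKernel 0 z ζ • F ζ) 0 1 =
        circleAverage (fun ζ => (2 : ℂ) • (((ζ - 0) / (ζ - z)) • F ζ) - F ζ) 0 1 := by
      refine Real.circleAverage_congr_sphere fun ζ hζ => ?_
      have h0 : ζ - z ≠ 0 := sub_ne_zero_of_norm_ne (by rw [mem_sphere_one hζ]; exact hz1.ne')
      simp only [herglotzRieszKernel, sub_zero, smul_eq_mul]
      field_simp; ring
    have h3 : CircleIntegrable (fun ζ => ((ζ - 0) / (ζ - z)) • F ζ) 0 1 := by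
      refine ContinuousOn.circleIntegrable' (ContinuousOn.fun_smul ?_ hc)
      refine ContinuousOn.div (by fun_prop) (by fun_prop) fun ζ hζ => ?_
      exact sub_ne_zero_of_norm_ne (by rw [mem_sphere_one hζ]; exact hz1.ne')
    rw [e, Real.circleAverage_fun_sub _ hi, Real.circleAverage_fun_smul]
    · have hF' : DiffContOnCl ℂ F (ball 0 |(1 : ℝ)|) := by rwa [abs_one]
      rw [hF'.circleAverage_smul_div (by rwa [abs_one]), hF'.circleAverage]
      simp
    · exact CircleIntegrable.const_smul h3
  have hd : HasDerivAt (fun w => 2 * F w - F 0) (2 * deriv F w) w :=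
    ((hF.1.differentiableAt (isOpen_ball.mem_nhds hw)).hasDerivAt.const_mul 2).sub_const _
  have h4 := (h1.congr_of_eventuallyEq h2.symm).unique hd
  have h5 : circleAverage (fun ζ => (2 * ζ / (ζ - w) ^ 2) • F ζ) 0 1 =
      (2 : ℂ) • circleAverage (fun ζ => ζ / (ζ - w) ^ 2 * F ζ) 0 1 := by
    rw [← Real.circleAverage_fun_smul]
    congr 1; ext ζ; simp only [smul_eq_mul]; ring
  rw [h5, smul_eq_mul] at h4
  exact (mul_left_cancel₀ two_ne_zero h4).symm

/-- Cauchy's theorem, the pole being outside the disk. It allows the kernel at the reflected point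
to be subtracted from Cauchy's formula at no cost. -/
theorem circleAverage_outside {F : ℂ → ℂ} (hF : DiffContOnCl ℂ F (ball 0 1)) {v : ℂ}
    (hv : 1 < ‖v‖) : circleAverage (fun ζ => ζ / (ζ - v) ^ 2 * F ζ) 0 1 = 0 := by
  rw [Real.circleAverage_eq_circleIntegral one_ne_zero]
  have hd : DifferentiableOn ℂ (fun ζ : ℂ => ((ζ - v) ^ 2)⁻¹) (closure (ball 0 1)) := by
    rw [closure_ball 0 one_ne_zero]
    refine DifferentiableOn.inv (by fun_prop) fun ζ hζ => pow_ne_zero _ ?_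
    exact sub_ne_zero_of_norm_ne (((mem_closedBall_zero_iff.1 hζ).trans_lt hv).ne)
  have h := (hd.diffContOnCl.smul hF).circleIntegral_eq_zero zero_le_one
  rw [circleIntegral.integral_congr (g := fun ζ => ((ζ - v) ^ 2)⁻¹ • F ζ) zero_le_one, h, smul_zero]
  intro ζ hζ
  have h0 : ζ ≠ 0 := by rintro rfl; simp at hζ
  simp only [sub_zero, smul_eq_mul]
  field_simp

theorem norm_sub_le_two_mul {ξ ζ : ℂ} {r : ℝ} (hξ : ‖ξ‖ = 1) (hζ : ‖ζ‖ = 1) (h0 : 0 < r)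
    (h1 : r < 1) : ‖ζ - ξ‖ ≤ 2 * ‖ζ - r * ξ‖ := by
  have hr : ‖(r : ℂ) * ξ‖ = r := by simp [hξ, abs_of_pos h0]
  have h2 : 1 - r ≤ ‖ζ - r * ξ‖ := by
    have := norm_sub_norm_le ζ (r * ξ); rwa [hr, hζ] at this
  have h3 : ‖(r : ℂ) * ξ - ξ‖ = 1 - r := by
    rw [← sub_one_mul, norm_mul, hξ, mul_one, ← Complex.ofReal_one, ← Complex.ofReal_sub,
      Complex.norm_real, Real.norm_eq_abs, abs_of_neg (by linarith)]; ring
  have h4 := norm_sub_le_norm_sub_add_norm_sub ζ (r * ξ) ξ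
  linarith

/-- Multiplied by `‖ζ - ξ‖`, the kernel `ζ/(ζ - rξ)²` alone has means growing like `log 1/(1 - r)`.
Subtracting the kernel at the reflected point `ξ/r` gains a factor of order `(1 - r²)/‖ζ - rξ‖`,
which leaves a Poisson kernel. -/
theorem norm_kernel_sub_le {ξ ζ : ℂ} {r : ℝ} (hξ : ‖ξ‖ = 1) (hζ : ‖ζ‖ = 1) (h0 : 0 < r)
    (h1 : r < 1) :
    ‖ζ / (ζ - r * ξ) ^ 2 - ζ / (ζ - (r : ℂ)⁻¹ * ξ) ^ 2‖ * ‖ζ - ξ‖ ≤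
      4 * poissonKernel 0 (r * ξ) ζ := by
  set w : ℂ := r * ξ with hw
  set v : ℂ := (r : ℂ)⁻¹ * ξ with hv
  have hwn : ‖w‖ = r := by simp [hw, hξ, abs_of_pos h0]
  have hvn : ‖v‖ = r⁻¹ := by simp [hv, hξ, abs_of_pos h0]
  have hrC : (r : ℂ) ≠ 0 := by exact_mod_cast h0.ne'
  have hrinv : 1 < r⁻¹ := (one_lt_inv₀ h0).2 h1
  have hw0 : ζ - w ≠ 0 := sub_ne_zero_of_norm_ne (by rw [hζ, hwn]; exact h1.ne')
  have hv0 : ζ - v ≠ 0 := sub_ne_zero_of_norm_ne (by rw [hζ, hvn]; exact hrinv.ne)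
  set A := ‖ζ - w‖ with hA
  have hApos : 0 < A := norm_pos_iff.2 hw0
  -- `w` and `v` are inverse points of the unit circle, so the ratio of the distances to them is
  -- constant there.
  have hB : ‖ζ - v‖ = r⁻¹ * A := by
    have hsq : ‖ζ - v‖ ^ 2 = (r⁻¹ * A) ^ 2 := by
      have e1 := Complex.normSq_sub ζ v
      have e2 := Complex.normSq_sub ζ w
      simp only [Complex.normSq_eq_norm_sq, hζ, hwn, hvn] at e1 e2
      have e3 : (ζ * (starRingEnd ℂ) v).re = r⁻¹ * (ζ * (starRingEnd ℂ) ξ).re := by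
        simp only [hv, ← Complex.ofReal_inv, map_mul, Complex.conj_ofReal]
        rw [mul_left_comm, Complex.re_ofReal_mul]
      have e4 : (ζ * (starRingEnd ℂ) w).re = r * (ζ * (starRingEnd ℂ) ξ).re := by
        simp only [hw, map_mul, Complex.conj_ofReal]
        rw [mul_left_comm, Complex.re_ofReal_mul]
      rw [mul_pow, hA, e1, e2, e3, e4]
      field_simp; ring
    exact (sq_eq_sq₀ (norm_nonneg _) (by positivity)).1 hsq
  have hwv : ‖w - v‖ = r⁻¹ - r := by
    have : w - v = ((r - r⁻¹ : ℝ) : ℂ) * ξ := by rw [hw, hv]; push_cast; ring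
    rw [this, norm_mul, hξ, mul_one, Complex.norm_real, Real.norm_eq_abs,
      abs_of_neg (by linarith)]; ring
  have hid : ζ / (ζ - w) ^ 2 - ζ / (ζ - v) ^ 2 =
      ζ * (w - v) * ((ζ - w) + (ζ - v)) / ((ζ - w) ^ 2 * (ζ - v) ^ 2) := by
    field_simp; ring
  have hP : poissonKernel 0 w ζ = (1 - r ^ 2) / A ^ 2 := by
    simp [poissonKernel, hζ, hwn, hA]
  have hK : ‖ζ / (ζ - w) ^ 2 - ζ / (ζ - v) ^ 2‖ ≤ 2 * ((1 - r ^ 2) / A ^ 3) := by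
    rw [hid, norm_div, norm_mul, norm_mul, norm_mul, norm_pow, norm_pow, hζ, hwv, hB, ← hA]
    have h2 : ‖(ζ - w) + (ζ - v)‖ ≤ A + r⁻¹ * A := (norm_add_le _ _).trans (by rw [hB])
    calc 1 * (r⁻¹ - r) * ‖(ζ - w) + (ζ - v)‖ / (A ^ 2 * (r⁻¹ * A) ^ 2)
        ≤ 1 * (r⁻¹ - r) * (A + r⁻¹ * A) / (A ^ 2 * (r⁻¹ * A) ^ 2) := by
          have : 0 ≤ r⁻¹ - r := by linarith
          gcongr
      _ = (1 + r) * ((1 - r ^ 2) / A ^ 3) := by field_simp; ring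
      _ ≤ 2 * ((1 - r ^ 2) / A ^ 3) := by
          have : 0 ≤ 1 - r ^ 2 := by nlinarith
          gcongr; linarith
  have hξ2 : ‖ζ - ξ‖ ≤ 2 * A := norm_sub_le_two_mul hξ hζ h0 h1
  have h5 : 0 ≤ (1 - r ^ 2) / A ^ 3 := div_nonneg (by nlinarith) (by positivity)
  calc _ ≤ 2 * ((1 - r ^ 2) / A ^ 3) * (2 * A) := by gcongr
    _ = 4 * poissonKernel 0 w ζ := by rw [hP]; field_simp; ring

theorem continuousOn_poissonKernel {w : ℂ} (hw : ‖w‖ < 1) :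
    ContinuousOn (poissonKernel 0 w) (sphere (0 : ℂ) |(1 : ℝ)|) := by
  unfold poissonKernel
  refine ContinuousOn.div (by fun_prop) (by fun_prop) fun ζ hζ => ?_
  have : ζ - w ≠ 0 := sub_ne_zero_of_norm_ne (by rw [mem_sphere_one hζ]; exact hw.ne')
  simpa using this

theorem circleAverage_poissonKernel {w : ℂ} (hw : ‖w‖ < 1) :
    circleAverage (poissonKernel 0 w) 0 1 = 1 := by
  have h := DiffContOnCl.circleAverage_poissonKernel_smul (c := 0) (R := 1) (w := w)
    (f := fun _ => (1 : ℂ)) diffContOnCl_const (by simpa using hw)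
  have h2 := (Complex.ofRealCLM.circleAverage_comp_comm
    (continuousOn_poissonKernel hw).circleIntegrable')
  have e : (poissonKernel 0 w • fun _ => (1 : ℂ)) = Complex.ofRealCLM ∘ poissonKernel 0 w := by
    ext z; simp
  rw [e, h2] at h
  simpa using h

theorem norm_circleAverage_le {E : Type*} [NormedAddCommGroup E] [NormedSpace ℝ E]
    (f : ℂ → E) (R : ℝ) : ‖circleAverage f 0 R‖ ≤ circleAverage (fun z => ‖f z‖) 0 R := by
  rw [Real.circleAverage_def, Real.circleAverage_def, norm_smul, Real.norm_eq_abs,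
    abs_of_pos (by positivity), smul_eq_mul]
  gcongr
  exact intervalIntegral.norm_integral_le_integral_norm (by positivity)

/-- If `E` vanishes to order greater than one at a boundary point along the circle, then its
derivative tends to zero radially there. -/
theorem tendsto_deriv_radial {E : ℂ → ℂ} (hE : DiffContOnCl ℂ E (ball 0 1)) {ξ : ℂ}
    (hξ : ‖ξ‖ = 1) {M : ℝ} (hM : ∀ ζ, ‖ζ‖ = 1 → ‖E ζ‖ ≤ M * ‖ζ - ξ‖)
    (ho : ∀ ε > 0, ∃ δ > 0, ∀ ζ, ‖ζ‖ = 1 → ‖ζ - ξ‖ < δ → ‖E ζ‖ ≤ ε * ‖ζ - ξ‖) :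
    Tendsto (fun r : ℝ => deriv E (r * ξ)) (𝓝[<] 1) (𝓝 0) := by
  have hc : ContinuousOn E (sphere (0 : ℂ) |(1 : ℝ)|) := by
    rw [abs_one]
    exact hE.2.mono (sphere_subset_closedBall.trans_eq (closure_ball 0 one_ne_zero).symm)
  -- Test the bound at the antipode of `ξ`.
  have hM0 : 0 ≤ M := by
    have h := (norm_nonneg _).trans (hM (-ξ) (by simpa using hξ))
    have h2 : 0 < ‖-ξ - ξ‖ := norm_pos_iff.2 (by
      intro h0
      have : ξ = 0 := by linear_combination (-1 / 2) * h0
      simp [this] at hξ)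
    exact nonneg_of_mul_nonneg_left h h2
  -- Split the circle at distance `δ` from `ξ`. Near `ξ` the Poisson kernel has mean at most one and
  -- contributes `4ε`; away from `ξ` it is at most `(1 - r²)/(δ/2)²`, which gives the constant
  -- `16M/δ²`.
  have key : ∀ ε > 0, ∃ C : ℝ, ∀ r ∈ Ioo (0 : ℝ) 1,
      ‖deriv E (r * ξ)‖ ≤ 4 * ε + C * (1 - r ^ 2) := by
    intro ε hε
    obtain ⟨δ, hδ, hd⟩ := ho ε hε
    refine ⟨16 * M / δ ^ 2, fun r hr => ?_⟩
    have hwn : ‖(r : ℂ) * ξ‖ = r := by simp [hξ, abs_of_pos hr.1]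
    have hvn : ‖(r : ℂ)⁻¹ * ξ‖ = r⁻¹ := by simp [hξ, abs_of_pos hr.1]
    have hw1 : ‖(r : ℂ) * ξ‖ < 1 := by rw [hwn]; exact hr.2
    have hv1 : 1 < ‖(r : ℂ)⁻¹ * ξ‖ := by rw [hvn]; exact (one_lt_inv₀ hr.1).2 hr.2
    have c1 : ContinuousOn (fun ζ => ζ / (ζ - r * ξ) ^ 2 * E ζ) (sphere (0 : ℂ) |(1 : ℝ)|) := by
      refine ContinuousOn.mul (ContinuousOn.div (by fun_prop) (by fun_prop) fun ζ hζ => ?_) hc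
      exact pow_ne_zero _ (sub_ne_zero_of_norm_ne (by rw [mem_sphere_one hζ]; exact hw1.ne'))
    have c2 : ContinuousOn (fun ζ => ζ / (ζ - (r : ℂ)⁻¹ * ξ) ^ 2 * E ζ)
        (sphere (0 : ℂ) |(1 : ℝ)|) := by
      refine ContinuousOn.mul (ContinuousOn.div (by fun_prop) (by fun_prop) fun ζ hζ => ?_) hc
      exact pow_ne_zero _ (sub_ne_zero_of_norm_ne (by rw [mem_sphere_one hζ]; exact hv1.ne))
    have e1 : deriv E (r * ξ) = circleAverage (fun ζ => ζ / (ζ - r * ξ) ^ 2 * E ζ -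
        ζ / (ζ - (r : ℂ)⁻¹ * ξ) ^ 2 * E ζ) 0 1 := by
      rw [Real.circleAverage_fun_sub c1.circleIntegrable' c2.circleIntegrable',
        circleAverage_outside hE hv1, sub_zero, deriv_eq_circleAverage hE (by simpa using hw1)]
    have hP := continuousOn_poissonKernel hw1
    rw [e1]
    refine (norm_circleAverage_le _ _).trans ?_
    have e2 : circleAverage (fun ζ => (4 * ε) • poissonKernel 0 (r * ξ) ζ +
        16 * M / δ ^ 2 * (1 - r ^ 2)) 0 1 = 4 * ε + 16 * M / δ ^ 2 * (1 - r ^ 2) := by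
      rw [Real.circleAverage_fun_add, Real.circleAverage_fun_smul, circleAverage_poissonKernel hw1,
        Real.circleAverage_const, smul_eq_mul, mul_one]
      · exact (hP.const_smul (4 * ε)).circleIntegrable'
      · exact continuousOn_const.circleIntegrable'
    rw [← e2]
    refine Real.circleAverage_mono (c1.sub c2).norm.circleIntegrable'
      ((hP.const_smul (4 * ε)).add continuousOn_const).circleIntegrable' fun ζ hζ => ?_
    have hζ1 := mem_sphere_one hζ
    have hk := norm_kernel_sub_le hξ hζ1 hr.1 hr.2
    set K := ζ / (ζ - r * ξ) ^ 2 - ζ / (ζ - (r : ℂ)⁻¹ * ξ) ^ 2 with hK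
    have hr2 : 0 ≤ 1 - r ^ 2 := by nlinarith [hr.1, hr.2]
    have hP0 : 0 ≤ poissonKernel 0 (r * ξ) ζ := by
      simp only [poissonKernel, sub_zero, hζ1, hwn, one_pow]
      exact div_nonneg hr2 (sq_nonneg _)
    rw [← sub_mul, norm_mul, smul_eq_mul]
    by_cases hfar : ‖ζ - ξ‖ < δ
    · calc ‖K‖ * ‖E ζ‖ ≤ ‖K‖ * (ε * ‖ζ - ξ‖) := by gcongr; exact hd ζ hζ1 hfar
        _ = ε * (‖K‖ * ‖ζ - ξ‖) := by ring
        _ ≤ ε * (4 * poissonKernel 0 (r * ξ) ζ) := mul_le_mul_of_nonneg_left hk hε.le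
        _ = 4 * ε * poissonKernel 0 (r * ξ) ζ + 0 := by ring
        _ ≤ _ := add_le_add_right (by positivity) _
    · have h3 : δ ≤ 2 * ‖ζ - r * ξ‖ :=
        (not_lt.1 hfar).trans (norm_sub_le_two_mul hξ hζ1 hr.1 hr.2)
      have h4 : poissonKernel 0 (r * ξ) ζ ≤ (1 - r ^ 2) / (δ / 2) ^ 2 := by
        simp only [poissonKernel, sub_zero, hζ1, hwn, one_pow]
        gcongr; linarith
      calc ‖K‖ * ‖E ζ‖ ≤ ‖K‖ * (M * ‖ζ - ξ‖) := by gcongr; exact hM ζ hζ1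
        _ = M * (‖K‖ * ‖ζ - ξ‖) := by ring
        _ ≤ M * (4 * ((1 - r ^ 2) / (δ / 2) ^ 2))
          := mul_le_mul_of_nonneg_left (hk.trans (by gcongr)) hM0
        _ = 0 + 16 * M / δ ^ 2 * (1 - r ^ 2) := by field_simp; ring
        _ ≤ _ := add_le_add_left (by positivity) _
  rw [NormedAddGroup.tendsto_nhds_zero]
  intro η hη
  obtain ⟨C, hC⟩ := key (η / 8) (by positivity)
  have hlim : Tendsto (fun r : ℝ => 4 * (η / 8) + C * (1 - r ^ 2)) (𝓝[<] 1)
      (𝓝 (4 * (η / 8) + C * (1 - 1 ^ 2))) :=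
    (Continuous.tendsto (by fun_prop) _).mono_left nhdsWithin_le_nhds
  filter_upwards [hlim.eventually (gt_mem_nhds (show _ < η by ring_nf; linarith)),
    Ioo_mem_nhdsLT (zero_lt_one' ℝ)] with r h1 h2
  exact (hC r h2).trans_lt h1

theorem lipschitzWith_exp_mul_I : LipschitzWith 1 fun t : ℝ => Complex.exp (t * Complex.I) := by
  refine LipschitzWith.of_dist_le_mul fun t s => ?_
  have h : Complex.exp (t * Complex.I) - Complex.exp (s * Complex.I) =
      Complex.exp (s * Complex.I) * (Complex.exp (Complex.I * ((t - s : ℝ) : ℂ)) - 1) := by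
    rw [mul_sub, ← Complex.exp_add, mul_one]
    congr 2; push_cast; ring
  rw [dist_eq_norm, h, norm_mul, Complex.norm_exp_ofReal_mul_I, one_mul, NNReal.coe_one, one_mul,
    dist_eq_norm]
  exact Real.norm_exp_I_mul_ofReal_sub_one_le

/-- **Fatou's theorem**: a bounded analytic function has radial limits almost everywhere. -/
theorem ae_exists_radial_limit {φ : ℂ → ℂ} (hφ : DifferentiableOn ℂ φ (ball 0 1))
    (hφm : MapsTo φ (ball 0 1) (ball 0 1)) :
    ∀ᵐ t : ℝ, ∃ l, Tendsto (fun r : ℝ => φ (r * Complex.exp (t * Complex.I))) (𝓝[<] 1) (𝓝 l) := by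
  -- A primitive of `φ` is 1-Lipschitz on the disk because `‖φ‖ < 1`. A Lipschitz extension to the
  -- plane gives it boundary values, whose restriction to the circle is differentiable almost
  -- everywhere.
  obtain ⟨Φ₀, hΦ₀⟩ := hφ.isExactOn_ball
  have hlip : LipschitzOnWith 1 Φ₀ (ball 0 1) :=
    (convex_ball 0 1).lipschitzOnWith_of_nnnorm_hasDerivWithin_le
      (fun z hz => (hΦ₀ z hz).hasDerivWithinAt) fun z hz => by
        have : ‖φ z‖ < 1 := by simpa using hφm hz
        exact_mod_cast this.le
  obtain ⟨Φ, hΦl, hΦe⟩ := hlip.extend_finite_dimension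
  have hΦd : ∀ z ∈ ball (0 : ℂ) 1, HasDerivAt Φ (φ z) z := fun z hz =>
    (hΦ₀ z hz).congr_of_eventuallyEq
      (by filter_upwards [isOpen_ball.mem_nhds hz] with w hw using (hΦe hw).symm)
  have hdc : DiffContOnCl ℂ Φ (ball 0 1) :=
    ⟨fun z hz => (hΦd z hz).differentiableAt.differentiableWithinAt, hΦl.continuous.continuousOn⟩
  filter_upwards [(hΦl.comp lipschitzWith_exp_mul_I).ae_differentiableAt_real] with t₀ ht₀
  set K : NNReal := lipschitzExtensionConstant ℂ * 1 with hK
  set ξ : ℂ := Complex.exp (t₀ * Complex.I) with hξ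
  have hξ1 : ‖ξ‖ = 1 := Complex.norm_exp_ofReal_mul_I t₀
  have hξ0 : ξ ≠ 0 := Complex.exp_ne_zero _
  set D := deriv (Φ ∘ fun t : ℝ => Complex.exp (t * Complex.I)) t₀
  -- The tangential derivative divided by the derivative of `e^{it}`: the only candidate for the
  -- radial limit. Subtracting the affine function of slope `L` leaves `E`, which is `o(‖ζ - ξ‖)`
  -- along the circle.
  set L : ℂ := D / (ξ * Complex.I) with hL
  let E : ℂ → ℂ := fun z => Φ z - (Φ ξ + L * (z - ξ))
  have hEd : ∀ z ∈ ball (0 : ℂ) 1, HasDerivAt E (φ z - L) z := fun z hz => by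
    have := (hΦd z hz).sub (((hasDerivAt_id z).sub_const ξ).const_mul L |>.const_add (Φ ξ))
    simp only [mul_one] at this
    exact this
  have hEc : DiffContOnCl ℂ E (ball 0 1) :=
    ⟨fun z hz => (hEd z hz).differentiableAt.differentiableWithinAt,
      (hΦl.continuous.sub (by fun_prop)).continuousOn⟩
  have hM : ∀ ζ, ‖ζ‖ = 1 → ‖E ζ‖ ≤ (K + ‖L‖) * ‖ζ - ξ‖ := fun ζ _ => by
    have h1 : ‖Φ ζ - Φ ξ‖ ≤ K * ‖ζ - ξ‖ := by
      simpa only [dist_eq_norm] using hΦl.dist_le_mul ζ ξ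
    have h2 : E ζ = (Φ ζ - Φ ξ) - L * (ζ - ξ) := by simp only [E]; ring
    rw [h2]
    refine (norm_sub_le _ _).trans ?_
    rw [norm_mul, add_mul]
    gcongr
  have hE0 : HasDerivAt (fun t : ℝ => E (Complex.exp (t * Complex.I))) 0 t₀ := by
    have h1 : HasDerivAt (fun t : ℝ => Complex.exp (t * Complex.I)) (ξ * Complex.I) t₀ := by
      have := (((hasDerivAt_id t₀).ofReal_comp).mul_const Complex.I).cexp
      simpa using this
    have h2 := ht₀.hasDerivAt.sub (((h1.sub_const ξ).const_mul L).const_add (Φ ξ))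
    have h3 : D - L * (ξ * Complex.I) = 0 := by
      rw [hL, div_mul_cancel₀ _ (mul_ne_zero hξ0 Complex.I_ne_zero), sub_self]
    rw [h3] at h2
    exact h2
  have hEξ : E ξ = 0 := by simp [E]
  have ho : ∀ ε > 0, ∃ δ > 0, ∀ ζ, ‖ζ‖ = 1 → ‖ζ - ξ‖ < δ → ‖E ζ‖ ≤ ε * ‖ζ - ξ‖ := by
    intro ε hε
    have h1 := (hasDerivAt_iff_isLittleO.1 hE0).bound
      (show 0 < ε / (Real.pi / 2) by positivity)
    rw [Metric.eventually_nhds_iff] at h1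
    obtain ⟨δ, hδ, hd⟩ := h1
    refine ⟨δ / (Real.pi / 2), by positivity, fun ζ hζ hζξ => ?_⟩
    set s := (ζ / ξ).arg with hs
    have hζ0 : ζ ≠ 0 := by rintro rfl; simp at hζ
    -- Arc length is at most `π/2` times the chord, which turns the little-o in the angle into one
    -- in `‖ζ - ξ‖`.
    have hsle : |s| ≤ Real.pi / 2 * ‖ζ - ξ‖ := by
      rw [hs, ← Complex.angle_eq_abs_arg hζ0 hξ0]
      exact Complex.angle_le_mul_norm_sub hζ hξ1
    have hζe : Complex.exp (((t₀ + s : ℝ) : ℂ) * Complex.I) = ζ := by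
      have h2 := Complex.norm_mul_exp_arg_mul_I (ζ / ξ)
      rw [norm_div, hζ, hξ1, div_one, Complex.ofReal_one, one_mul] at h2
      rw [Complex.ofReal_add, add_mul, Complex.exp_add, h2, ← hξ]
      field_simp
    have h3 := hd (y := t₀ + s) (by
      rw [Real.dist_eq, add_sub_cancel_left]
      refine hsle.trans_lt ?_
      rw [lt_div_iff₀ (by positivity)] at hζξ
      linarith)
    rw [hζe, ← hξ, hEξ] at h3
    simp only [sub_zero, smul_zero, add_sub_cancel_left, Real.norm_eq_abs] at h3
    refine h3.trans ?_
    calc ε / (Real.pi / 2) * |s| ≤ ε / (Real.pi / 2) * (Real.pi / 2 * ‖ζ - ξ‖) := by gcongr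
      _ = ε * ‖ζ - ξ‖ := by field_simp
  refine ⟨L, ?_⟩
  have h := (tendsto_deriv_radial hEc hξ1 hM ho).add_const L
  rw [zero_add] at h
  refine h.congr' ?_
  filter_upwards [Ioo_mem_nhdsLT (zero_lt_one' ℝ)] with r hr
  have hz : (r : ℂ) * ξ ∈ ball (0 : ℂ) 1 := by
    simpa [hξ1, abs_of_pos hr.1] using hr.2
  rw [(hEd _ hz).deriv, sub_add_cancel]

theorem mean2_eq_circleAverage (f : ℂ → ℂ) (r : ℝ) :
    mean2 f r = circleAverage (fun z => ‖f z‖ ^ 2) 0 r := by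
  simp [mean2, Real.circleAverage_def, circleMap]

end HardySpace

/-! ### Point evaluations and orthonormal bases of the Hardy space -/

namespace H2
open HardySpace

theorem mean2_le_norm_sq (f : H2) {r : ℝ} (hr : r ∈ Ioo (0 : ℝ) 1) : mean2 f r ≤ ‖f‖ ^ 2 :=
  (isLUB_norm_sq f).1 ⟨r, hr, rfl⟩

/-- The means increase with `r`, by the Taylor coefficient formula, so their supremum is their
limit. -/
theorem tendsto_mean2 (f : H2) : Tendsto (mean2 f) (𝓝[<] 1) (𝓝 (‖f‖ ^ 2)) := by
  refine tendsto_order.2 ⟨fun a ha => ?_, fun a ha => ?_⟩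
  · obtain ⟨_, ⟨r, hr, rfl⟩, h1, -⟩ := (isLUB_norm_sq f).exists_between ha
    filter_upwards [Ico_mem_nhdsLT hr.2] with s hs
    refine h1.trans_le (hasSum_le (fun n => ?_) (hasSum_mean2_coeff f.2.1 hr.1.le hr.2)
      (hasSum_mean2_coeff f.2.1 (hr.1.le.trans hs.1) hs.2))
    have := hr.1.le
    have := hs.1
    gcongr
  · filter_upwards [Ioo_mem_nhdsLT (zero_lt_one' ℝ)] with r hr
    exact (mean2_le_norm_sq f hr).trans_lt ha

/-- The reproducing kernel of the Hardy space. -/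
theorem exists_reproducing_kernel {a : ℂ} (ha : ‖a‖ < 1) :
    ∃ k : H2, (∀ f : H2, inner ℂ k f = f a) ∧ ‖k‖ ^ 2 = (1 - ‖a‖ ^ 2)⁻¹ := by
  have hg : HasSum (fun n : ℕ => (‖a‖ ^ 2) ^ n) (1 - ‖a‖ ^ 2)⁻¹ :=
    hasSum_geometric_of_lt_one (sq_nonneg _) (pow_lt_one₀ (norm_nonneg _) ha two_ne_zero)
  have hmem : Memℓp (fun n : ℕ => (starRingEnd ℂ) a ^ n) 2 := by
    rw [memℓp_gen_iff (by simp)]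
    refine hg.summable.congr fun n => ?_
    simp [← pow_mul, mul_comm]
  obtain ⟨k, hk⟩ := coeffs_surjective ⟨_, hmem⟩
  refine ⟨k, fun f => ?_, ?_⟩
  · have h1 : inner ℂ k f = inner ℂ (coeffs k) (coeffs f) := rfl
    rw [h1, hk]
    refine (lp.hasSum_inner _ _).unique ?_
    refine (hasSum_taylor f.2.1 ha).congr_fun fun n => ?_
    simp [coeffs]
  · rw [← norm_coeffs, hk]
    have h := lp.norm_rpow_eq_tsum (p := 2) (by simp)
      (⟨_, hmem⟩ : lp (fun _ : ℕ => ℂ) 2)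
    simp only [ENNReal.toReal_ofNat, Real.rpow_ofNat] at h
    rw [h, ← hg.tsum_eq]
    refine tsum_congr fun n => ?_
    simp [← pow_mul, mul_comm]

theorem norm_apply_sq_le (f : H2) {a : ℂ} (ha : ‖a‖ < 1) :
    ‖f a‖ ^ 2 ≤ ‖f‖ ^ 2 * (1 - ‖a‖ ^ 2)⁻¹ := by
  obtain ⟨k, hk, hn⟩ := exists_reproducing_kernel ha
  rw [← hk, ← hn, ← mul_pow, mul_comm]
  gcongr
  exact norm_inner_le_norm k f

theorem sum_norm_apply_sq_le {ι : Type*} {v : ι → H2} (hv : Orthonormal ℂ v) (s : Finset ι)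
    {a : ℂ} (ha : ‖a‖ < 1) : ∑ i ∈ s, ‖v i a‖ ^ 2 ≤ (1 - ‖a‖ ^ 2)⁻¹ := by
  obtain ⟨k, hk, hn⟩ := exists_reproducing_kernel ha
  rw [← hn]
  refine (Finset.sum_le_sum fun i _ => ?_).trans (hv.sum_inner_products_le k (s := s))
  rw [← hk, norm_inner_symm]

theorem hasSum_norm_apply_sq {ι : Type*} (b : HilbertBasis ι ℂ H2) {a : ℂ} (ha : ‖a‖ < 1) :
    HasSum (fun i => ‖b i a‖ ^ 2) (1 - ‖a‖ ^ 2)⁻¹ := by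
  obtain ⟨k, hk, hn⟩ := exists_reproducing_kernel ha
  have h := b.hasSum_inner_mul_inner k k
  rw [inner_self_eq_norm_sq_to_K] at h
  rw [← hn, ← Complex.hasSum_ofReal]
  push_cast
  refine h.congr_fun fun i => ?_
  rw [hk, ← inner_conj_symm (b i) k, hk, Complex.mul_conj, Complex.normSq_eq_norm_sq]
  push_cast; rfl

/-- Each Taylor coefficient is an inner product with some `e n`, which meets only countably many
basis vectors; a basis vector orthogonal to every `e n` would vanish. Countability is needed to
integrate series over the basis term by term. -/
theorem countable_of_hilbertBasis {ι : Type*} (b : HilbertBasis ι ℂ H2) : Countable ι := by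
  have h : ∀ n : ℕ, ∃ e : H2, ∀ f : H2, inner ℂ e f = coeff f n := fun n => by
    obtain ⟨e, he⟩ := coeffs_surjective (lp.single 2 n (1 : ℂ))
    refine ⟨e, fun f => ?_⟩
    have h1 : inner ℂ e f = inner ℂ (coeffs e) (coeffs f) := rfl
    rw [h1, he, lp.inner_single_left]
    simp [coeffs]
  choose e he using h
  have hcov : (univ : Set ι) ⊆ ⋃ n : ℕ, Function.support fun i => ‖inner ℂ (b i) (e n)‖ ^ 2 := by
    intro i _
    by_contra hi
    simp only [mem_iUnion, Function.mem_support, not_exists, not_not] at hi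
    refine b.orthonormal.ne_zero i (coeffs_injective (Subtype.ext (funext fun n => ?_)))
    have h2 := hi n
    rw [norm_inner_symm, he, sq_eq_zero_iff, norm_eq_zero] at h2
    rw [map_zero]
    exact h2
  exact countable_univ_iff.1 ((countable_iUnion fun n =>
    (b.orthonormal.inner_products_summable (e n)).countable_support).mono hcov)

end H2

/-! ### The boundary integral -/

namespace HardySpace
open Real (circleAverage)

theorem injOn_exp_mul_I :
    InjOn (fun t : ℝ => Complex.exp (t * Complex.I)) (Ioc 0 (2 * Real.pi)) := by
  intro s hs t ht h
  obtain ⟨n, hn⟩ := Complex.exp_eq_exp_iff_exists_int.1 h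
  have h1 : s = t + n * (2 * Real.pi) := by
    have h2 : ((s : ℂ) - (t + n * (2 * Real.pi))) * Complex.I = 0 := by linear_combination hn
    have h3 := (mul_eq_zero.1 h2).resolve_right Complex.I_ne_zero
    exact_mod_cast sub_eq_zero.1 h3
  have hpi := Real.pi_pos
  have h4 : n = 0 := by
    have h5 : (n : ℝ) < 1 := by
      by_contra! hc
      have : 1 * (2 * Real.pi) ≤ n * (2 * Real.pi) := by gcongr
      linarith [hs.2, ht.1]
    have h6 : (-1 : ℝ) < n := by
      by_contra! hc
      have : n * (2 * Real.pi) ≤ -1 * (2 * Real.pi) := by gcongr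
      linarith [hs.1, ht.2]
    have h7 : n < 1 := by exact_mod_cast h5
    have h8 : -1 < n := by exact_mod_cast h6
    omega
  simpa [h4] using h1

/-- Integration over the circle in the angular variable; no measurability is needed, since the
parametrization is a measurable embedding. -/
theorem lintegral_circleMeasure (F : ℂ → ℝ≥0∞) :
    ∫⁻ ξ, F ξ ∂circleMeasure = ENNReal.ofReal (2 * Real.pi)⁻¹ *
      ∫⁻ t in Ioc 0 (2 * Real.pi), F (Complex.exp (t * Complex.I)) := by
  set e : ℝ → ℂ := fun t => Complex.exp (t * Complex.I) with he
  have hec : Continuous e := by fun_prop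
  have hI : MeasurableSet (Ioc 0 (2 * Real.pi)) := measurableSet_Ioc
  have := hI.standardBorel
  have hemb : MeasurableEmbedding ((Ioc 0 (2 * Real.pi)).domRestrict e) :=
    (hec.measurable.comp measurable_subtype_coe).measurableEmbedding
      (injOn_iff_injective.1 injOn_exp_mul_I)
  have hmap : Measure.map e (volume.restrict (Ioc 0 (2 * Real.pi))) =
      Measure.map ((Ioc 0 (2 * Real.pi)).domRestrict e) (Measure.comap Subtype.val volume) := by
    rw [← map_comap_subtype_coe hI volume, Measure.map_map hec.measurable measurable_subtype_coe]
    rfl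
  rw [circleMeasure, Measure.map_smul, lintegral_smul_measure, hmap, hemb.lintegral_map,
    smul_eq_mul]
  congr 1
  exact lintegral_subtype_comap hI fun t => F (e t)

/-- Continuity as a map into `[0, ∞]` includes the points of value `∞`, so limits may be taken even
where `|φ*| = 1`. -/
theorem continuous_logInvDist : Continuous logInvDist := by
  unfold logInvDist
  refine EReal.continuous_toENNReal.comp (ENNReal.continuous_log.comp ?_)
  simp only [one_div]
  exact continuous_inv.comp ((ENNReal.continuous_sub_left (by simp)).comp continuous_enorm)

theorem logInvDist_of_norm_lt_one {ζ : ℂ} (h : ‖ζ‖ < 1) :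
    logInvDist ζ = ENNReal.ofReal (-Real.log (1 - ‖ζ‖)) := by
  have h1 : (1 : ℝ≥0∞) - ‖ζ‖ₑ = ENNReal.ofReal (1 - ‖ζ‖) := by
    rw [ENNReal.ofReal_sub _ (norm_nonneg _), ENNReal.ofReal_one, ofReal_norm]
  rw [logInvDist, h1, one_div, ENNReal.log_inv, ENNReal.log_ofReal_of_pos (by linarith),
    ← EReal.coe_neg, EReal.real_coe_toENNReal]

theorem logInvDist_of_one_le_norm {ζ : ℂ} (h : 1 ≤ ‖ζ‖) : logInvDist ζ = ⊤ := by
  have h1 : (1 : ℝ≥0∞) - ‖ζ‖ₑ = 0 := by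
    rw [tsub_eq_zero_iff_le, ← ofReal_norm]
    exact ENNReal.one_le_ofReal.2 h
  simp [logInvDist, h1]

theorem tendsto_radialLimit {φ : ℂ → ℂ} {ξ l : ℂ}
    (h : Tendsto (fun r : ℝ => φ (r * ξ)) (𝓝[<] 1) (𝓝 l)) :
    Tendsto (fun r : ℝ => φ (r * ξ)) (𝓝[<] 1) (𝓝 (radialLimit φ ξ)) :=
  tendsto_nhds_limUnder ⟨l, h⟩

theorem circleMap_mem_ball {r : ℝ} (hr : r ∈ Ioo (0 : ℝ) 1) (t : ℝ) :
    circleMap 0 r t ∈ ball (0 : ℂ) 1 := by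
  simpa [abs_of_pos hr.1] using hr.2

theorem sphere_subset_unit_ball {r : ℝ} (hr : r ∈ Ioo (0 : ℝ) 1) :
    sphere (0 : ℂ) |r| ⊆ ball 0 1 := by
  rw [abs_of_pos hr.1]
  exact sphere_subset_closedBall.trans (closedBall_subset_ball hr.2)

/-! ### Necessity: logarithmic means -/

/-- By Jensen's formula the logarithmic means of a nonzero analytic function are bounded below. -/
theorem exists_le_circleAverage_log_norm {w : ℂ → ℂ} (hw : DifferentiableOn ℂ w (ball 0 1)) :
    ∃ C : ℝ, ∀ r ∈ Ico (1 / 2 : ℝ) 1, C ≤ circleAverage (fun z => Real.log ‖w z‖) 0 r := by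
  have ha := hw.analyticOnNhd isOpen_ball
  -- In Jensen's formula the zeros off the origin contribute nonnegatively. The zero at the origin
  -- contributes its order times `log r`, which is smallest at `r = 1/2`.
  refine ⟨(meromorphicOrderAt w 0).untop₀ * Real.log (1 / 2) +
    Real.log ‖meromorphicTrailingCoeffAt w 0‖, fun r hr => ?_⟩
  have hr0 : 0 < r := by linarith [hr.1]
  have hsub : closedBall (0 : ℂ) |r| ⊆ ball 0 1 := by
    rw [abs_of_pos hr0]; exact closedBall_subset_ball hr.2
  have ha' := ha.mono hsub
  rw [ha'.meromorphicOn.circleAverage_log_norm hr0.ne']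
  have hd := MeromorphicOn.AnalyticOnNhd.divisor_nonneg ha'
  have hd0 : (0 : ℝ) ≤ MeromorphicOn.divisor w (closedBall 0 |r|) 0 := by exact_mod_cast hd 0
  have h1 : 0 ≤ ∑ᶠ u, (MeromorphicOn.divisor w (closedBall 0 |r|) u : ℝ) *
      Real.log (r * ‖(0 : ℂ) - u‖⁻¹) := by
    refine finsum_nonneg fun u => ?_
    by_cases hu : u ∈ closedBall (0 : ℂ) |r|
    · refine mul_nonneg (by exact_mod_cast hd u) ?_
      -- At `u = 0` the term vanishes by the conventions `0⁻¹ = 0` and `log 0 = 0`.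
      rcases eq_or_ne u 0 with rfl | hu0
      · simp
      · refine Real.log_nonneg ?_
        have h2 : ‖u‖ ≤ r := by simpa [abs_of_pos hr0] using hu
        rw [zero_sub, norm_neg, ← div_eq_mul_inv, one_le_div (norm_pos_iff.2 hu0)]
        exact h2
    · rw [Function.locallyFinsuppWithin.apply_eq_zero_of_notMem _ hu]; simp
  have h2 : Real.log (1 / 2) ≤ Real.log r := Real.log_le_log (by norm_num) hr.1
  have h3 : MeromorphicOn.divisor w (closedBall 0 |r|) 0 = (meromorphicOrderAt w 0).untop₀ :=
    MeromorphicOn.divisor_apply ha'.meromorphicOn (by simp)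
  rw [h3] at hd0 ⊢
  have h4 := mul_le_mul_of_nonneg_left h2 hd0
  linarith

theorem one_sub_norm_sq_pos {a : ℂ} (ha : ‖a‖ < 1) : 0 < 1 - ‖a‖ ^ 2 := by
  nlinarith [norm_nonneg a]

theorem continuous_comp_circleMap {f : ℂ → ℂ} (hf : DifferentiableOn ℂ f (ball 0 1)) {r : ℝ}
    (hr : r ∈ Ioo (0 : ℝ) 1) : Continuous fun t => f (circleMap 0 r t) :=
  hf.continuousOn.comp_continuous (continuous_circleMap 0 r) (circleMap_mem_ball hr)

/-- The quadratic means of `w / (1 - |φ|²)^{1/2}` are bounded by the Hilbert–Schmidt norm. -/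
theorem circleAverage_le_of_hilbertBasis {φ : ℂ → ℂ} (hφ : DifferentiableOn ℂ φ (ball 0 1))
    (hφm : MapsTo φ (ball 0 1) (ball 0 1)) {w : H2} {T : H2 →L[ℂ] H2}
    (hT : ∀ f : H2, ∀ z ∈ ball (0 : ℂ) 1, T f z = weightedComp w φ f z) {ι : Type*}
    (b : HilbertBasis ι ℂ H2) (hs : Summable fun i => ‖T (b i)‖ ^ 2) {r : ℝ}
    (hr : r ∈ Ioo (0 : ℝ) 1) :
    circleAverage (fun z => ‖w z‖ ^ 2 * (1 - ‖φ z‖ ^ 2)⁻¹) 0 r ≤ ∑' i, ‖T (b i)‖ ^ 2 := by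
  have := H2.countable_of_hilbertBasis b
  have hφ1 : ∀ t, ‖φ (circleMap 0 r t)‖ < 1 := fun t => by
    simpa using hφm (circleMap_mem_ball hr t)
  have hpi : (0 : ℝ) ≤ 2 * Real.pi := by positivity
  set μ := volume.restrict (Ioc 0 (2 * Real.pi))
  have hcF : ∀ i, Continuous fun t => ‖T (b i) (circleMap 0 r t)‖ ^ 2 := fun i =>
    (continuous_comp_circleMap (T (b i)).2.1 hr).norm.pow 2
  have hint : ∀ f : ℝ → ℝ, Continuous f → Integrable f μ := fun f hf =>
    (hf.intervalIntegrable 0 (2 * Real.pi)).1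
  have hpt : ∀ t, HasSum (fun i => ‖T (b i) (circleMap 0 r t)‖ ^ 2)
      (‖w (circleMap 0 r t)‖ ^ 2 * (1 - ‖φ (circleMap 0 r t)‖ ^ 2)⁻¹) := fun t => by
    refine ((H2.hasSum_norm_apply_sq b (hφ1 t)).mul_left _).congr_fun fun i => ?_
    rw [hT _ _ (circleMap_mem_ball hr t), weightedComp, norm_mul, mul_pow]
  have hcG : Continuous fun t =>
      ‖w (circleMap 0 r t)‖ ^ 2 * (1 - ‖φ (circleMap 0 r t)‖ ^ 2)⁻¹ := by
    refine ((continuous_comp_circleMap w.2.1 hr).norm.pow 2).mul (Continuous.inv₀ ?_ fun t => ?_)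
    · exact continuous_const.sub ((continuous_comp_circleMap hφ hr).norm.pow 2)
    · exact (one_sub_norm_sq_pos (hφ1 t)).ne'
  have hi : ∀ i, ∫ t, ‖T (b i) (circleMap 0 r t)‖ ^ 2 ∂μ ≤ 2 * Real.pi * ‖T (b i)‖ ^ 2 := by
    intro i
    have h := H2.mean2_le_norm_sq (T (b i)) hr
    rw [mean2_eq_circleAverage, Real.circleAverage_def, smul_eq_mul,
      inv_mul_le_iff₀ (by positivity), intervalIntegral.integral_of_le hpi] at h
    exact h
  have key : ∫ t, ‖w (circleMap 0 r t)‖ ^ 2 * (1 - ‖φ (circleMap 0 r t)‖ ^ 2)⁻¹ ∂μ ≤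
      2 * Real.pi * ∑' i, ‖T (b i)‖ ^ 2 := by
    have hs2 : Summable fun i => ∫ t, ‖T (b i) (circleMap 0 r t)‖ ^ 2 ∂μ :=
      Summable.of_nonneg_of_le (fun i => integral_nonneg fun t => sq_nonneg _) hi
        (hs.mul_left _)
    -- The terms are nonnegative, so summable integrals suffice to exchange sum and integral.
    have h1 := hasSum_integral_of_summable_integral_norm (μ := μ)
      (F := fun i t => ‖T (b i) (circleMap 0 r t)‖ ^ 2) (fun i => hint _ (hcF i))
      (hs2.congr fun i => by simp)
    simp_rw [fun t => (hpt t).tsum_eq] at h1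
    rw [← tsum_mul_left]
    exact hasSum_le hi h1 (hs.mul_left _).hasSum
  rw [Real.circleAverage_def, smul_eq_mul, inv_mul_le_iff₀ (by positivity),
    intervalIntegral.integral_of_le hpi]
  exact key

/-- Apply `log y ≤ y` to `y = x²/(1 - a)`, then use `1/(1 - a) = (1 + a)/(1 - a²) ≤ 2/(1 - a²)`.
Here `a = |φ|` and `x = |w|`. -/
theorem neg_log_one_sub_le {a x : ℝ} (ha0 : 0 ≤ a) (ha : a < 1) (hx : 0 < x) :
    -Real.log (1 - a) ≤ 2 * (x ^ 2 * (1 - a ^ 2)⁻¹) - 2 * Real.log x := by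
  have h1 : 0 < 1 - a := by linarith
  have h2 : Real.log (x ^ 2 / (1 - a)) ≤ x ^ 2 / (1 - a) :=
    (Real.log_le_sub_one_of_pos (by positivity)).trans (by linarith)
  rw [Real.log_div (by positivity) h1.ne', Real.log_pow] at h2
  have h3 : x ^ 2 / (1 - a) ≤ 2 * (x ^ 2 * (1 - a ^ 2)⁻¹) := by
    have e : 1 - a ^ 2 = (1 - a) * (1 + a) := by ring
    rw [e, ← div_eq_mul_inv, mul_div_assoc', div_le_div_iff₀ h1 (by positivity)]
    have : 0 ≤ x ^ 2 * (1 - a) * (1 - a) := by positivity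
    nlinarith
  push_cast at h2
  linarith

/-- A nonzero analytic function vanishes almost nowhere on a circle. -/
theorem ae_ne_zero_circleMap {w : ℂ → ℂ} (hw : DifferentiableOn ℂ w (ball 0 1)) {z₀ : ℂ}
    (hz₀ : z₀ ∈ ball (0 : ℂ) 1) (hne : w z₀ ≠ 0) {r : ℝ} (hr : r ∈ Ioo (0 : ℝ) 1) :
    ∀ᵐ t ∂volume.restrict (Ioc 0 (2 * Real.pi)), w (circleMap 0 r t) ≠ 0 := by
  have h1 := (hw.analyticOnNhd isOpen_ball).preimage_zero_mem_codiscreteWithin hne hz₀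
    ((convex_ball 0 1).isConnected ⟨z₀, hz₀⟩)
  have h2 := codiscreteWithin_mono (sphere_subset_unit_ball hr) h1
  exact ae_restrict_le_codiscreteWithin measurableSet_Ioc
    (codiscreteWithin_mono (subset_univ _) (circleMap_preimage_codiscrete hr.1.ne' h2))

theorem exists_circleAverage_neg_log_le {φ : ℂ → ℂ} (hφ : DifferentiableOn ℂ φ (ball 0 1))
    (hφm : MapsTo φ (ball 0 1) (ball 0 1)) {w : H2} (hw : w ≠ 0) {T : H2 →L[ℂ] H2}
    (hT : ∀ f : H2, ∀ z ∈ ball (0 : ℂ) 1, T f z = weightedComp w φ f z)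
    (hHS : IsHilbertSchmidt T) :
    ∃ C : ℝ, ∀ r ∈ Ico (1 / 2 : ℝ) 1,
      circleAverage (fun z => -Real.log (1 - ‖φ z‖)) 0 r ≤ C := by
  obtain ⟨s, b, hs⟩ := hHS
  obtain ⟨C, hC⟩ := exists_le_circleAverage_log_norm w.2.1
  obtain ⟨z₀, hz₀, hne⟩ : ∃ z ∈ ball (0 : ℂ) 1, w z ≠ 0 := by
    by_contra! hc
    refine hw (Subtype.ext (funext fun z => ?_))
    by_cases hz : z ∈ ball (0 : ℂ) 1
    · exact hc z hz
    · exact w.2.2.1 z hz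
  refine ⟨2 * (∑' i, ‖T (b i)‖ ^ 2) - 2 * C, fun r hr' => ?_⟩
  have hr : r ∈ Ioo (0 : ℝ) 1 := ⟨by linarith [hr'.1], hr'.2⟩
  have hφ1 : ∀ t, ‖φ (circleMap 0 r t)‖ < 1 := fun t => by
    simpa using hφm (circleMap_mem_ball hr t)
  have hφc := (continuous_comp_circleMap hφ hr).norm
  have i1 : CircleIntegrable (fun z => ‖w z‖ ^ 2 * (1 - ‖φ z‖ ^ 2)⁻¹) 0 r := by
    refine Continuous.intervalIntegrable ?_ _ _
    refine ((continuous_comp_circleMap w.2.1 hr).norm.pow 2).mul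
      (Continuous.inv₀ (continuous_const.sub (hφc.pow 2)) fun t => ?_)
    exact (one_sub_norm_sq_pos (hφ1 t)).ne'
  have i2 : CircleIntegrable (fun z => Real.log ‖w z‖) 0 r :=
    ((w.2.1.analyticOnNhd isOpen_ball).mono
      (sphere_subset_unit_ball hr)).meromorphicOn.circleIntegrable_log_norm
  have i3 : CircleIntegrable (fun z => -Real.log (1 - ‖φ z‖)) 0 r := by
    refine Continuous.intervalIntegrable ?_ _ _
    exact ((continuous_const.sub hφc).log fun t => (sub_pos.2 (hφ1 t)).ne').neg
  have j1 : CircleIntegrable (fun z => (2 : ℝ) • (‖w z‖ ^ 2 * (1 - ‖φ z‖ ^ 2)⁻¹)) 0 r :=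
    i1.const_smul
  have j2 : CircleIntegrable (fun z => (2 : ℝ) • Real.log ‖w z‖) 0 r := i2.const_smul
  have hle : circleAverage (fun z => -Real.log (1 - ‖φ z‖)) 0 r ≤
      circleAverage (fun z => (2 : ℝ) • (‖w z‖ ^ 2 * (1 - ‖φ z‖ ^ 2)⁻¹) -
        (2 : ℝ) • Real.log ‖w z‖) 0 r := by
    rw [Real.circleAverage_def, Real.circleAverage_def, smul_eq_mul, smul_eq_mul]
    refine mul_le_mul_of_nonneg_left ?_ (by positivity)
    have hpi : (0 : ℝ) ≤ 2 * Real.pi := by positivity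
    rw [intervalIntegral.integral_of_le hpi, intervalIntegral.integral_of_le hpi]
    refine integral_mono_ae i3.1 (j1.sub j2).1 ?_
    -- At zeros of `w` the convention `log 0 = 0` can break the pointwise inequality, but these are
    -- null on the circle.
    filter_upwards [ae_ne_zero_circleMap w.2.1 hz₀ hne hr] with t ht
    exact neg_log_one_sub_le (norm_nonneg _) (hφ1 t) (norm_pos_iff.2 ht)
  rw [Real.circleAverage_fun_sub j1 j2,
    Real.circleAverage_fun_smul, Real.circleAverage_fun_smul] at hle
  have h1 := circleAverage_le_of_hilbertBasis hφ hφm hT b hs hr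
  have h2 := hC r hr'
  simp only [smul_eq_mul] at hle
  linarith

/-- Fatou's lemma along radii increasing to 1. -/
theorem lintegral_logInvDist_lt_top {φ : ℂ → ℂ} (hφ : DifferentiableOn ℂ φ (ball 0 1))
    (hφm : MapsTo φ (ball 0 1) (ball 0 1)) {C : ℝ}
    (hC : ∀ r ∈ Ico (1 / 2 : ℝ) 1, circleAverage (fun z => -Real.log (1 - ‖φ z‖)) 0 r ≤ C) :
    ∫⁻ ξ, logInvDist (radialLimit φ ξ) ∂circleMeasure < ⊤ := by
  rw [lintegral_circleMeasure]
  refine ENNReal.mul_lt_top ENNReal.ofReal_lt_top ?_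
  set μ := volume.restrict (Ioc 0 (2 * Real.pi))
  obtain ⟨u, -, hu, hul⟩ := exists_seq_strictMono_tendsto' (show (1 / 2 : ℝ) < 1 by norm_num)
  have hun : Tendsto u atTop (𝓝[<] 1) :=
    tendsto_nhdsWithin_iff.2 ⟨hul, Eventually.of_forall fun n => (hu n).2⟩
  have hu' : ∀ n, u n ∈ Ioo (0 : ℝ) 1 := fun n => ⟨by linarith [(hu n).1], (hu n).2⟩
  have hφ1 : ∀ n t, ‖φ (circleMap 0 (u n) t)‖ < 1 := fun n t => by
    simpa using hφm (circleMap_mem_ball (hu' n) t)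
  have hlim : ∀ᵐ t ∂μ, Tendsto (fun n => logInvDist (φ (circleMap 0 (u n) t))) atTop
      (𝓝 (logInvDist (radialLimit φ (Complex.exp (t * Complex.I))))) := by
    filter_upwards [ae_restrict_of_ae (ae_exists_radial_limit hφ hφm)] with t ⟨l, hl⟩
    have h := (continuous_logInvDist.tendsto _).comp ((tendsto_radialLimit hl).comp hun)
    simpa only [circleMap, zero_add, Function.comp_def] using h
  have hpi : (0 : ℝ) ≤ 2 * Real.pi := by positivity
  have hbd : ∀ n, ∫⁻ t, logInvDist (φ (circleMap 0 (u n) t)) ∂μ ≤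
      ENNReal.ofReal (2 * Real.pi * C) := fun n => by
    have hc : Continuous fun t => -Real.log (1 - ‖φ (circleMap 0 (u n) t)‖) :=
      ((continuous_const.sub (continuous_comp_circleMap hφ (hu' n)).norm).log
        fun t => (sub_pos.2 (hφ1 n t)).ne').neg
    have hn : ∀ t, 0 ≤ -Real.log (1 - ‖φ (circleMap 0 (u n) t)‖) := fun t => by
      have h0 := norm_nonneg (φ (circleMap 0 (u n) t))
      exact neg_nonneg.2 (Real.log_nonpos (sub_pos.2 (hφ1 n t)).le (by linarith))
    simp_rw [fun t => logInvDist_of_norm_lt_one (hφ1 n t)]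
    rw [← ofReal_integral_eq_lintegral_ofReal (hc.intervalIntegrable 0 (2 * Real.pi)).1
      (ae_of_all _ hn)]
    refine ENNReal.ofReal_le_ofReal ?_
    have h := hC (u n) ⟨(hu n).1.le, (hu n).2⟩
    rw [Real.circleAverage_def, smul_eq_mul, inv_mul_le_iff₀ (by positivity),
      intervalIntegral.integral_of_le hpi] at h
    exact h
  calc _ = ∫⁻ t, liminf (fun n => logInvDist (φ (circleMap 0 (u n) t))) atTop ∂μ :=
        lintegral_congr_ae (by filter_upwards [hlim] with t ht using ht.liminf_eq.symm)
    _ ≤ liminf (fun n => ∫⁻ t, logInvDist (φ (circleMap 0 (u n) t)) ∂μ) atTop :=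
        lintegral_liminf_le' fun n => (continuous_logInvDist.comp
          (continuous_comp_circleMap hφ (hu' n))).measurable.aemeasurable
    _ ≤ ENNReal.ofReal (2 * Real.pi * C) :=
        liminf_le_of_le (by isBoundedDefault) fun b hb => by
          obtain ⟨n, hn⟩ := hb.exists
          exact hn.trans (hbd n)
    _ < ⊤ := ENNReal.ofReal_lt_top

/-! ### Poisson representation by boundary values -/

theorem ae_tendsto_radialLimit {φ : ℂ → ℂ} (hφ : DifferentiableOn ℂ φ (ball 0 1))
    (hφm : MapsTo φ (ball 0 1) (ball 0 1)) : ∀ᵐ t : ℝ,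
    Tendsto (fun r : ℝ => φ (r * circleMap 0 1 t)) (𝓝[<] 1)
      (𝓝 (radialLimit φ (circleMap 0 1 t))) := by
  filter_upwards [ae_exists_radial_limit hφ hφm] with t ⟨l, hl⟩
  have e : circleMap 0 1 t = Complex.exp (t * Complex.I) := by simp [circleMap]
  rw [e]
  exact tendsto_radialLimit hl

theorem continuous_dilate {φ : ℂ → ℂ} (hφ : DifferentiableOn ℂ φ (ball 0 1)) {r : ℝ}
    (hr : r ∈ Ioo (0 : ℝ) 1) :
    Continuous fun t => φ (r * circleMap 0 1 t) := by
  refine hφ.continuousOn.comp_continuous (by fun_prop) fun t => ?_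
  simpa [abs_of_pos hr.1] using hr.2

/-- Measurability is not evident from `limUnder`; it comes from almost everywhere convergence of
continuous dilates. -/
theorem aemeasurable_radialLimit {φ : ℂ → ℂ} (hφ : DifferentiableOn ℂ φ (ball 0 1))
    (hφm : MapsTo φ (ball 0 1) (ball 0 1)) :
    AEMeasurable fun t : ℝ => radialLimit φ (circleMap 0 1 t) := by
  obtain ⟨u, -, hu, hul⟩ := exists_seq_strictMono_tendsto' (zero_lt_one' ℝ)
  have hun : Tendsto u atTop (𝓝[<] 1) :=
    tendsto_nhdsWithin_iff.2 ⟨hul, Eventually.of_forall fun n => (hu n).2⟩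
  refine aemeasurable_of_tendsto_metrizable_ae' (f := fun n t => φ (u n * circleMap 0 1 t))
    (fun n => (continuous_dilate hφ (hu n)).measurable.aemeasurable) ?_
  filter_upwards [ae_tendsto_radialLimit hφ hφm] with t ht
  exact ht.comp hun

/-- A bounded analytic function is the Poisson integral of its radial limits. -/
theorem circleAverage_poissonKernel_radialLimit {φ : ℂ → ℂ} (hφ : DifferentiableOn ℂ φ (ball 0 1))
    (hφm : MapsTo φ (ball 0 1) (ball 0 1)) {z : ℂ} (hz : ‖z‖ < 1) :
    circleAverage (fun ζ => poissonKernel 0 z ζ • radialLimit φ ζ) 0 1 = φ z := by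
  have hPc : Continuous fun t => poissonKernel 0 z (circleMap 0 1 t) :=
    (continuousOn_poissonKernel hz).comp_continuous (continuous_circleMap 0 1) fun t => by simp
  have hlim : Tendsto (fun r : ℝ => circleAverage (fun ζ => poissonKernel 0 z ζ • φ (r * ζ)) 0 1)
      (𝓝[<] 1) (𝓝 (circleAverage (fun ζ => poissonKernel 0 z ζ • radialLimit φ ζ) 0 1)) := by
    simp only [Real.circleAverage_def]
    refine Tendsto.const_smul ?_ _
    refine intervalIntegral.tendsto_integral_filter_of_dominated_convergence
      (fun t => ‖poissonKernel 0 z (circleMap 0 1 t)‖) ?_ ?_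
      (hPc.norm.intervalIntegrable _ _) ?_
    · filter_upwards [Ioo_mem_nhdsLT (zero_lt_one' ℝ)] with r hr
      exact (hPc.smul (continuous_dilate hφ hr)).aestronglyMeasurable
    · filter_upwards [Ioo_mem_nhdsLT (zero_lt_one' ℝ)] with r hr
      refine ae_of_all _ fun t _ => ?_
      have h : ((r : ℂ) * circleMap 0 1 t) ∈ ball (0 : ℂ) 1 := by
        simpa [abs_of_pos hr.1] using hr.2
      rw [norm_smul]
      exact mul_le_of_le_one_right (norm_nonneg _) (mem_ball_zero_iff.1 (hφm h)).le
    · filter_upwards [ae_tendsto_radialLimit hφ hφm] with t ht _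
      exact ht.const_smul _
  -- Each dilate `φ (r ζ)` is analytic past the closed disk, so its Poisson average is `φ (r z)`,
  -- which tends to `φ z`.
  refine tendsto_nhds_unique hlim ?_
  have hcont : Tendsto (fun r : ℝ => φ (r * z)) (𝓝[<] 1) (𝓝 (φ z)) := by
    have h1 : ContinuousAt φ (((1 : ℝ) : ℂ) * z) :=
      (hφ.differentiableAt (isOpen_ball.mem_nhds (by simpa using hz))).continuousAt
    have h2 : ContinuousAt (fun r : ℝ => φ (r * z)) 1 :=
      ContinuousAt.comp (f := fun r : ℝ => (r : ℂ) * z) h1 (by fun_prop)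
    simpa using h2.tendsto.mono_left nhdsWithin_le_nhds
  refine hcont.congr' ?_
  filter_upwards [Ioo_mem_nhdsLT (zero_lt_one' ℝ)] with r hr
  have hd : DiffContOnCl ℂ (fun ζ => φ (r * ζ)) (ball 0 1) := by
    refine DifferentiableOn.diffContOnCl ?_
    rw [closure_ball 0 one_ne_zero]
    refine hφ.comp (by fun_prop) fun ζ hζ => ?_
    have h1 : ‖ζ‖ ≤ 1 := by simpa using hζ
    have h2 : r * ‖ζ‖ ≤ r * 1 := mul_le_mul_of_nonneg_left h1 hr.1.le
    simp only [mem_ball_zero_iff, norm_mul, Complex.norm_real, Real.norm_eq_abs,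
      abs_of_pos hr.1]
    linarith [hr.2]
  exact (hd.circleAverage_poissonKernel_smul (by simpa using hz)).symm

/-- The boundary function `log (1 - |φ*|)`. -/
theorem circleIntegrable_log_one_sub {φ : ℂ → ℂ} (hφ : DifferentiableOn ℂ φ (ball 0 1))
    (hφm : MapsTo φ (ball 0 1) (ball 0 1))
    (hfin : ∫⁻ ξ, logInvDist (radialLimit φ ξ) ∂circleMeasure < ⊤) :
    CircleIntegrable (fun ζ => Real.log (1 - ‖radialLimit φ ζ‖)) 0 1 ∧
      ∀ᵐ t ∂volume.restrict (Ioc 0 (2 * Real.pi)), ‖radialLimit φ (circleMap 0 1 t)‖ < 1 := by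
  have hpi : (0 : ℝ) < 2 * Real.pi := by positivity
  have e : ∀ t : ℝ, Complex.exp (t * Complex.I) = circleMap 0 1 t := fun t => by simp [circleMap]
  rw [lintegral_circleMeasure] at hfin
  simp only [e] at hfin
  set μ := volume.restrict (Ioc 0 (2 * Real.pi)) with hμ
  have hfin' : ∫⁻ t, logInvDist (radialLimit φ (circleMap 0 1 t)) ∂μ ≠ ⊤ :=
    (ENNReal.lt_top_of_mul_ne_top_right hfin.ne
      (ENNReal.ofReal_pos.2 (by positivity)).ne').ne
  have hm := (aemeasurable_radialLimit hφ hφm).mono_measure (Measure.restrict_le_self : μ ≤ volume)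
  have hlt : ∀ᵐ t ∂μ, ‖radialLimit φ (circleMap 0 1 t)‖ < 1 := by
    filter_upwards [ae_lt_top' (continuous_logInvDist.measurable.comp_aemeasurable hm) hfin']
      with t ht
    by_contra! hc
    exact ht.ne (logInvDist_of_one_le_norm hc)
  refine ⟨?_, hlt⟩
  refine (intervalIntegrable_iff_integrableOn_Ioc_of_le hpi.le).2 ⟨?_, ?_⟩
  · exact (Real.measurable_log.comp_aemeasurable (hm.norm.const_sub 1)).aestronglyMeasurable
  · refine lt_of_le_of_lt (lintegral_mono_ae ?_) hfin'.lt_top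
    filter_upwards [hlt] with t ht
    have h0 := norm_nonneg (radialLimit φ (circleMap 0 1 t))
    rw [logInvDist_of_norm_lt_one ht, ← ofReal_norm, Real.norm_eq_abs,
      abs_of_nonpos (Real.log_nonpos (sub_pos.2 ht).le (by linarith))]

/-! ### Sufficiency: the outer weight -/

/-- The outer function with boundary modulus `(1 - |φ*|)^{1/2}` satisfies `|w|² ≤ 1 - |φ|`. -/
theorem exists_weight {φ : ℂ → ℂ} (hφ : DifferentiableOn ℂ φ (ball 0 1))
    (hφm : MapsTo φ (ball 0 1) (ball 0 1))
    (hfin : ∫⁻ ξ, logInvDist (radialLimit φ ξ) ∂circleMeasure < ⊤) :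
    ∃ w : ℂ → ℂ, DifferentiableOn ℂ w (ball 0 1) ∧ (∀ z, w z ≠ 0) ∧
      ∀ z ∈ ball (0 : ℂ) 1, ‖w z‖ ^ 2 ≤ 1 - ‖φ z‖ := by
  obtain ⟨hu, hlt⟩ := circleIntegrable_log_one_sub hφ hφm hfin
  set u : ℂ → ℝ := fun ζ => Real.log (1 - ‖radialLimit φ ζ‖) with hu_def
  have huC : CircleIntegrable (fun ζ => (u ζ : ℂ)) 0 1 :=
    ⟨Complex.ofRealCLM.integrable_comp hu.1, Complex.ofRealCLM.integrable_comp hu.2⟩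
  -- `Re h` is the Poisson integral of `u`, so `w = exp (h/2)` has `|w|² = exp P[u]`.
  let h : ℂ → ℂ := fun z => circleAverage (fun ζ => herglotzRieszKernel 0 z ζ • (u ζ : ℂ)) 0 1
  have hh : DifferentiableOn ℂ h (ball 0 1) :=
    differentiableOn_circleAverage_herglotzRieszKernel_smul huC
  refine ⟨fun z => Complex.exp (h z / 2), (hh.div_const 2).cexp, fun z => Complex.exp_ne_zero _,
    fun z hz => ?_⟩
  have hz1 : ‖z‖ < 1 := by simpa using hz
  have hpi : (0 : ℝ) < 2 * Real.pi := by positivity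
  set μ := volume.restrict (Ioc 0 (2 * Real.pi)) with hμ
  set P : ℂ → ℝ := poissonKernel 0 z with hP
  have hPs := continuousOn_poissonKernel hz1
  have hPc : Continuous fun t => P (circleMap 0 1 t) :=
    hPs.comp_continuous (continuous_circleMap 0 1) fun t => by simp
  have hP0 : ∀ t, 0 ≤ P (circleMap 0 1 t) := fun t => by
    have : ‖z‖ ^ 2 ≤ 1 := pow_le_one₀ (norm_nonneg _) hz1.le
    simp only [hP, poissonKernel, sub_zero, norm_circleMap_zero, abs_one, one_pow]
    exact div_nonneg (by linarith) (sq_nonneg _)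
  have hPi : CircleIntegrable P 0 1 := hPs.circleIntegrable'
  have hPu : CircleIntegrable (fun ζ => P ζ * u ζ) 0 1 := hu.continuousOn_smul hPs
  set A := circleAverage (fun ζ => P ζ * u ζ) 0 1 with hA
  have hre : (h z).re = A := by
    have h1 := re_circleAverage_herglotzRieszKernel_smul hu hz
    rw [← poissonKernel_eq_re_herglotzRieszKernel] at h1
    exact h1
  have hw : ‖Complex.exp (h z / 2)‖ ^ 2 = Real.exp A := by
    rw [Complex.norm_exp, ← Real.exp_nat_mul, ← hre]
    congr 1
    simp
    ring
  rw [hw]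
  have hN : CircleIntegrable (fun ζ => P ζ * ‖radialLimit φ ζ‖) 0 1 := by
    refine (intervalIntegrable_iff_integrableOn_Ioc_of_le hpi.le).2 ?_
    refine Integrable.mono' (hPc.intervalIntegrable 0 (2 * Real.pi)).1 ?_ ?_
    · exact hPc.aestronglyMeasurable.mul ((aemeasurable_radialLimit hφ hφm).mono_measure
        Measure.restrict_le_self).norm.aestronglyMeasurable
    · filter_upwards [hlt] with t ht
      rw [norm_mul, norm_norm, Real.norm_eq_abs, abs_of_nonneg (hP0 t)]
      exact mul_le_of_le_one_right (hP0 t) ht.le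
  have hφle : ‖φ z‖ ≤ circleAverage (fun ζ => P ζ * ‖radialLimit φ ζ‖) 0 1 := by
    rw [← circleAverage_poissonKernel_radialLimit hφ hφm hz1]
    refine (norm_circleAverage_le _ _).trans (le_of_eq ?_)
    simp only [Real.circleAverage_def]
    congr 1
    refine intervalIntegral.integral_congr fun t _ => ?_
    simp only [norm_smul, Real.norm_eq_abs]
    rw [abs_of_nonneg (hP0 t)]
  have j1 : CircleIntegrable (fun ζ => (Real.exp A * (1 - A)) • P ζ) 0 1 := hPi.const_smul
  have j2 : CircleIntegrable (fun ζ => Real.exp A • (P ζ * u ζ)) 0 1 := hPu.const_smul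
  -- Jensen's inequality for the probability density `P`, through the tangent line of `exp` at `A`:
  -- `e^u ≥ e^A (1 - A + u)`. The left side averages to `e^A`, since `u` has `P`-mean `A`.
  have hle : circleAverage (fun ζ => (Real.exp A * (1 - A)) • P ζ + Real.exp A • (P ζ * u ζ)) 0 1 ≤
      circleAverage (fun ζ => P ζ - P ζ * ‖radialLimit φ ζ‖) 0 1 := by
    rw [Real.circleAverage_def, Real.circleAverage_def, smul_eq_mul, smul_eq_mul]
    refine mul_le_mul_of_nonneg_left ?_ (by positivity)
    rw [intervalIntegral.integral_of_le hpi.le, intervalIntegral.integral_of_le hpi.le]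
    refine integral_mono_ae (j1.add j2).1 (hPi.sub hN).1 ?_
    filter_upwards [hlt] with t ht
    have h1 : Real.exp A * (1 - A + u (circleMap 0 1 t)) ≤
        1 - ‖radialLimit φ (circleMap 0 1 t)‖ := by
      have h2 : Real.exp (u (circleMap 0 1 t)) = 1 - ‖radialLimit φ (circleMap 0 1 t)‖ :=
        Real.exp_log (sub_pos.2 ht)
      have h3 := Real.add_one_le_exp (u (circleMap 0 1 t) - A)
      rw [← h2, ← add_sub_cancel A (u (circleMap 0 1 t)), Real.exp_add, add_sub_cancel]
      refine mul_le_mul_of_nonneg_left ?_ (Real.exp_pos _).le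
      linarith
    have h4 := mul_le_mul_of_nonneg_left h1 (hP0 t)
    simp only [smul_eq_mul]
    linarith
  rw [Real.circleAverage_fun_add j1 j2, Real.circleAverage_fun_smul, Real.circleAverage_fun_smul,
    circleAverage_poissonKernel hz1, ← hA, Real.circleAverage_fun_sub hPi hN,
    circleAverage_poissonKernel hz1] at hle
  simp only [smul_eq_mul] at hle
  linarith

theorem circleAverage_le_of_le {g : ℂ → ℝ} (hg : ContinuousOn g (ball 0 1)) {C : ℝ}
    (hC : ∀ z ∈ ball (0 : ℂ) 1, g z ≤ C) {r : ℝ} (hr : r ∈ Ioo (0 : ℝ) 1) :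
    circleAverage g 0 r ≤ C :=
  Real.circleAverage_mono_on_of_le_circle
    ((hg.mono (sphere_subset_unit_ball hr)).circleIntegrable')
    fun z hz => hC z (sphere_subset_unit_ball hr hz)

/-- The weight cancels the factor `1/(1 - |φ|²)` in the bound for point evaluation at `φ z`, so `w ·
(f ∘ φ)` is bounded by `‖f‖`. The same cancellation in Bessel's inequality bounds `∑ ‖T (b i) z‖²`
by 1. -/
theorem exists_hilbertSchmidt_of_norm_sq_le {φ : ℂ → ℂ} (hφ : DifferentiableOn ℂ φ (ball 0 1))
    (hφm : MapsTo φ (ball 0 1) (ball 0 1)) {w : ℂ → ℂ} (hw : DifferentiableOn ℂ w (ball 0 1))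
    (hw0 : ∀ z ∉ ball (0 : ℂ) 1, w z = 0)
    (hwφ : ∀ z ∈ ball (0 : ℂ) 1, ‖w z‖ ^ 2 ≤ 1 - ‖φ z‖ ^ 2) :
    ∃ T : H2 →L[ℂ] H2, (∀ f : H2, ∀ z ∈ ball (0 : ℂ) 1, T f z = weightedComp w φ f z) ∧
      IsHilbertSchmidt T := by
  have hφ1 : ∀ z ∈ ball (0 : ℂ) 1, ‖φ z‖ < 1 := fun z hz => by simpa using hφm hz
  have hd : ∀ f : H2, DifferentiableOn ℂ (weightedComp w φ f) (ball 0 1) := fun f =>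
    hw.mul (f.2.1.comp hφ hφm)
  have hle : ∀ (f : H2), ∀ z ∈ ball (0 : ℂ) 1, ‖weightedComp w φ f z‖ ^ 2 ≤ ‖f‖ ^ 2 := by
    intro f z hz
    have hpos := one_sub_norm_sq_pos (hφ1 z hz)
    rw [weightedComp, norm_mul, mul_pow]
    calc ‖w z‖ ^ 2 * ‖f (φ z)‖ ^ 2
        ≤ (1 - ‖φ z‖ ^ 2) * (‖f‖ ^ 2 * (1 - ‖φ z‖ ^ 2)⁻¹) :=
          mul_le_mul (hwφ z hz) (H2.norm_apply_sq_le f (hφ1 z hz)) (sq_nonneg _) hpos.le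
      _ = ‖f‖ ^ 2 := by field_simp
  have hmean : ∀ (f : H2), ∀ r ∈ Ioo (0 : ℝ) 1, mean2 (weightedComp w φ f) r ≤ ‖f‖ ^ 2 := by
    intro f r hr
    rw [mean2_eq_circleAverage]
    exact circleAverage_le_of_le ((hd f).continuousOn.norm.pow 2) (hle f) hr
  let S : H2 → H2 := fun f => ⟨weightedComp w φ f, hd f,
    fun z hz => by simp [weightedComp, hw0 z hz], ⟨‖f‖ ^ 2, by
      rintro _ ⟨r, hr, rfl⟩
      exact hmean f r hr⟩⟩
  let L : H2 →ₗ[ℂ] H2 :=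
    { toFun := S
      map_add' := fun f g => Subtype.ext (funext fun z => mul_add _ _ _)
      map_smul' := fun a f => Subtype.ext (funext fun z => mul_left_comm _ _ _) }
  have hS : ∀ f, ‖L f‖ ≤ 1 * ‖f‖ := fun f => by
    rw [one_mul, ← sq_le_sq₀ (norm_nonneg _) (norm_nonneg _)]
    refine (H2.isLUB_norm_sq (L f)).2 ?_
    rintro _ ⟨r, hr, rfl⟩
    exact hmean f r hr
  let T : H2 →L[ℂ] H2 := L.mkContinuous 1 hS
  have hT : ∀ f : H2, (T f).1 = weightedComp w φ f := fun f => rfl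
  refine ⟨T, fun f z _ => congrFun (hT f) z, ?_⟩
  obtain ⟨s, b, -⟩ := exists_hilbertBasis ℂ H2
  refine ⟨s, b, summable_of_sum_le (c := 1) (fun i => sq_nonneg _) fun F => ?_⟩
  -- Each norm is a limit of circle means, so for finite sums a bound at every radius suffices.
  refine le_of_tendsto (tendsto_finsetSum F fun i _ => H2.tendsto_mean2 (T (b i))) ?_
  filter_upwards [Ioo_mem_nhdsLT (zero_lt_one' ℝ)] with r hr
  have hc : ∀ i, ContinuousOn (fun z => ‖T (b i) z‖ ^ 2) (ball 0 1) := fun i =>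
    (T (b i)).2.1.continuousOn.norm.pow 2
  simp only [mean2_eq_circleAverage]
  rw [← Real.circleAverage_fun_sum fun i _ =>
    ((hc i).mono (sphere_subset_unit_ball hr)).circleIntegrable']
  refine circleAverage_le_of_le (continuousOn_finsetSum F fun i _ => hc i) (fun z hz => ?_) hr
  have hpos := one_sub_norm_sq_pos (hφ1 z hz)
  calc ∑ i ∈ F, ‖T (b i) z‖ ^ 2 = ‖w z‖ ^ 2 * ∑ i ∈ F, ‖b i (φ z)‖ ^ 2 := by
        rw [Finset.mul_sum]
        refine Finset.sum_congr rfl fun i _ => ?_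
        rw [hT, weightedComp, norm_mul, mul_pow]
    _ ≤ (1 - ‖φ z‖ ^ 2) * (1 - ‖φ z‖ ^ 2)⁻¹ :=
        mul_le_mul (hwφ z hz) (H2.sum_norm_apply_sq_le b.orthonormal F (hφ1 z hz))
          (Finset.sum_nonneg fun i _ => sq_nonneg _) hpos.le
    _ = 1 := mul_inv_cancel₀ hpos.ne'

end HardySpace

/-! ### The equivalence -/

theorem mainTheorem3 (φ : ℂ → ℂ) (hφ : DifferentiableOn ℂ φ (Metric.ball 0 1))
    (hφm : Set.MapsTo φ (Metric.ball 0 1) (Metric.ball 0 1)) :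
    (∃ w : H2, w ≠ 0 ∧ ∃ T : H2 →L[ℂ] H2,
        (∀ f : H2, ∀ z ∈ Metric.ball (0 : ℂ) 1, T f z = weightedComp w φ f z) ∧
        IsHilbertSchmidt T) ↔
      ∫⁻ ξ, logInvDist (radialLimit φ ξ) ∂circleMeasure < ⊤ := by
  constructor
  · rintro ⟨w, hw, T, hT, hHS⟩
    obtain ⟨C, hC⟩ := HardySpace.exists_circleAverage_neg_log_le hφ hφm hw hT hHS
    exact HardySpace.lintegral_logInvDist_lt_top hφ hφm hC
  · intro hfin
    obtain ⟨w, hwd, hw0, hwφ⟩ := HardySpace.exists_weight hφ hφm hfin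
    -- The exponential never vanishes, whereas elements of `H2` must be zero off the disk.
    let v : ℂ → ℂ := (ball (0 : ℂ) 1).indicator w
    have hvw : ∀ z ∈ ball (0 : ℂ) 1, v z = w z := fun z hz => indicator_of_mem hz w
    have hvd : DifferentiableOn ℂ v (ball 0 1) := hwd.congr hvw
    have hv0 : ∀ z ∉ ball (0 : ℂ) 1, v z = 0 := fun z hz => indicator_of_notMem hz w
    have hvφ : ∀ z ∈ ball (0 : ℂ) 1, ‖v z‖ ^ 2 ≤ 1 - ‖φ z‖ ^ 2 := fun z hz => by
      have h1 : ‖φ z‖ < 1 := by simpa using hφm hz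
      rw [hvw z hz]
      nlinarith [hwφ z hz, norm_nonneg (φ z)]
    have hv1 : ∀ z ∈ ball (0 : ℂ) 1, ‖v z‖ ^ 2 ≤ 1 := fun z hz =>
      (hvφ z hz).trans (by linarith [sq_nonneg ‖φ z‖])
    refine ⟨⟨v, hvd, hv0, 1, ?_⟩, fun h => ?_,
      HardySpace.exists_hilbertSchmidt_of_norm_sq_le hφ hφm hvd hv0 hvφ⟩
    · rintro _ ⟨r, hr, rfl⟩
      rw [HardySpace.mean2_eq_circleAverage]
      exact HardySpace.circleAverage_le_of_le (hvd.continuousOn.norm.pow 2) hv1 hr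
    · refine hw0 0 ?_
      rw [← hvw 0 (by simp)]
      exact congrFun (congrArg Subtype.val h) 0
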